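/- **Model.** Let $\delta>-1$. Vertex $v_0$ is present at time $0$; at time $1$ vertex $v_1$ arrives and is joined to $v_0$ by an edge. For every $n\ge 1$, vertex $v_{n+1}$ arrives at time $n+1$ and is joined by a single edge to one of the vertices $v_0,\dots,v_n$: given the whole history of the tree up to time $n$, it is joined to $v_i$ with probability $$\frac{\theta(v_i,n)}{\sum_{j=0}^n\theta(v_j,n)},\qquad \theta(v_i,n)=\sum_{m=i}^n\big(d(v_i,m)+\delta\big),\qquad 0\le i\le n,$$ where, for $m\ge1$, $d(v_i,m)$ is the degree of $v_i$ at time $m$. The only term with $m=0$ is the one of $v_0$, and in it $d(v_0,0)$ is read as a fixed real number $d_0$ with $(d_0+\delta)+(1+\delta)\ge0$, i.e. such that $\theta(v_0,1)\ge 0$. (The choice $d_0=1$, i.e. the tree at time $0$ is by convention the tree at time $1$, is allowed for every $\delta>-1$; the choice $d_0=0$, i.e. $v_0$ is isolated at time $0$, is allowed for $\delta\ge-\tfrac12$.) Put $$\phi(\delta)=\tfrac12\big(1+\tfrac12\delta\big)\Big[1+\sqrt{1+4\big(1+\tfrac12\delta\big)^{-1}}\,\Big].$$ **Theorem 2.5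 (Degree growth).** For every fixed $i\ge1$ there is a random variable $\zeta_i\in L^1$ with $\mathbb E[\zeta_i]>0$ such that, as $n\to\infty$, $$n^{-1/\phi(\delta)}\,d(v_i,n)\longrightarrow\zeta_i\qquad\text{almost surely and in }L^1.$$ -/

import Mathlib

open MeasureTheory ProbabilityTheory Filter Topology

noncomputable section

namespace SelfReinforced

/-- The graph at time `n` of the growing tree in which vertex `k ≥ 1` attaches itself, on its arrival
at time `k`, to the vertex `x k`. Its vertices are `0, …, n` and its edges are `{k, x k}` for
`1 ≤ k ≤ n`; the numbers above `n` (vertices that have not arrived yet) are isolated. The value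
`x 0` is never used. -/
def tree (x : ℕ → ℕ) (n : ℕ) : SimpleGraph ℕ :=
  SimpleGraph.fromRel fun k j => 1 ≤ k ∧ k ≤ n ∧ x k = j

/-- The degree `d(v_i, n)` of vertex `i` at time `n`. -/
def degree (x : ℕ → ℕ) (i n : ℕ) : ℕ := ((tree x n).neighborSet i).ncard

/-- The degree that enters the weights. At the times `m ≥ 1` it is the degree in the tree. At time
`m = 0`, when there is no edge yet, only vertex `0` is concerned, and its degree is given the
conventional value `d₀` (`0` for an isolated vertex, `1` for the convention that the tree at time `0`
is the tree at time `1`). -/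
def weightDegree (d₀ : ℝ) (x : ℕ → ℕ) (i m : ℕ) : ℝ :=
  if m = 0 then d₀ else (degree x i m : ℝ)

/-- The weight `θ(v_i, n) = ∑_{m = i}^{n} (d(v_i, m) + δ)`. -/
def weight (δ d₀ : ℝ) (x : ℕ → ℕ) (i n : ℕ) : ℝ :=
  ∑ m ∈ Finset.Icc i n, (weightDegree d₀ x i m + δ)

/-- The event that the first `n` attachments are those prescribed by `x`. -/
def history {Ω : Type*} (a : ℕ → Ω → ℕ) (x : ℕ → ℕ) (n : ℕ) : Set Ω :=
  {ω | ∀ k ∈ Finset.Icc 1 n, a k ω = x k}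

/-- `a k` is the (random) vertex to which vertex `k ≥ 1` attaches itself. The process is the
self-reinforced preferential attachment tree if vertex `1` attaches itself to vertex `0` and, for
every `n ≥ 1`, given the whole history up to time `n`, vertex `n + 1` attaches itself to vertex
`i ∈ {0, …, n}` with probability `θ(v_i, n) / ∑_{j = 0}^{n} θ(v_j, n)`. -/
structure IsSelfReinforcedTree {Ω : Type*} [MeasurableSpace Ω] (μ : Measure Ω) (δ d₀ : ℝ)
    (a : ℕ → Ω → ℕ) : Prop where
  measurable : ∀ k, 1 ≤ k → Measurable (a k)
  first : ∀ᵐ ω ∂μ, a 1 ω = 0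
  step : ∀ n, 1 ≤ n → ∀ x : ℕ → ℕ, μ (history a x n) ≠ 0 → ∀ i ≤ n,
    (cond μ (history a x n)).real {ω | a (n + 1) ω = i} =
      weight δ d₀ x i n / ∑ j ∈ Finset.range (n + 1), weight δ d₀ x j n

/-- The exponent `φ(δ)`. -/
def phi (δ : ℝ) : ℝ :=
  1 / 2 * (1 + δ / 2) * (1 + √(1 + 4 * (1 + δ / 2)⁻¹))

/-- The rescaled degree `n^{-1/φ(δ)} d(v_i, n)`. -/
def scaledDegree {Ω : Type*} (δ : ℝ) (a : ℕ → Ω → ℕ) (i n : ℕ) (ω : Ω) : ℝ :=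
  (n : ℝ) ^ (-(1 / phi δ)) * (degree (fun k => a k ω) i n : ℝ)

end SelfReinforced

end

/-! Fix `i ≥ 1`, and let Y(n) be the degree of `i` plus δ and T(n) its sum from time `i` to `n`,
which is the weight of `i`. By the handshake lemma the total weight S(n) is deterministic
(`sum_weight`), asymptotically α n² with α = 1 + δ/2. So, given the past, Y increases by 1 with
probability T(n)/S(n), while T(n+1) = T(n) + Y(n+1): a linear system in (Y, T) with 1/n
coefficients.

With r = 1/φ(δ), the positive root of α r (r + 1) = 1 (`inv_phi_mul_add_one`), Y + r T/n is
asymptotically the growing mode, multiplied on average by 1 + r/(n+1) at each step. Dividing by g(n)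
= ∏ (1 + r/j), which is of order n^r, gives a positive process M that is a martingale up to relative
errors O(n⁻²) (`combine_succ`, `exists_totalWeight_bound`). The attachment noise contributes at most
a constant times M(n)/(n g(n)) to its second moment, and 1/(n g(n)) is summable. Hence M is bounded
in L² and converges almost surely to a limit L of positive mean
(`exists_tendsto_of_almost_martingale`).

A deterministic Stolz–Cesàro argument then recovers the limit of Y/g from that of M
(`tendsto_inv_growth_mul`), and Euler's product for Γ turns g(n) into n^r. Since the rescaled degree
is dominated by a multiple of M, it inherits the L² bound, which upgrades almost sure convergence to
L¹. -/

namespace SelfReinforced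

/-! ### Degrees and weights in the deterministic tree -/

/-- The number of vertices among `1, …, n` that attach themselves to `i`. -/
def attachCount (x : ℕ → ℕ) (i n : ℕ) : ℕ := ((Finset.Icc 1 n).filter fun k => x k = i).card

lemma attachCount_succ (x : ℕ → ℕ) (i n : ℕ) :
    attachCount x i (n + 1) = attachCount x i n + if x (n + 1) = i then 1 else 0 := by
  unfold attachCount
  rw [← Finset.insert_Icc_right_eq_Icc_add_one (by omega), Finset.filter_insert]
  split_ifs with h
  · rw [Finset.card_insert_of_notMem (by simp)]
  · simp

lemma attachCount_le (x : ℕ → ℕ) (i n : ℕ) : attachCount x i n ≤ n := by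
  unfold attachCount
  exact (Finset.card_filter_le _ _).trans (by simp)

lemma attachCount_congr {x y : ℕ → ℕ} {n : ℕ} (h : ∀ k ∈ Finset.Icc 1 n, x k = y k) (i : ℕ) :
    attachCount x i n = attachCount y i n := by
  unfold attachCount
  congr 1
  exact Finset.filter_congr fun k hk => by rw [h k hk]

/-- The first `n` attachments all go to earlier vertices. -/
def IsValid (x : ℕ → ℕ) (n : ℕ) : Prop := ∀ k ∈ Finset.Icc 1 n, x k < k

lemma IsValid.mono {x : ℕ → ℕ} {m n : ℕ} (h : IsValid x n) (hmn : m ≤ n) : IsValid x m :=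
  fun k hk => h k (Finset.Icc_subset_Icc_right hmn hk)

/-- The children of `i` are larger than `i` and its parent is smaller, so validity excludes loops
and double counting. Vertex 0 has no parent, whence the indicator. -/
lemma degree_eq {x : ℕ → ℕ} {n : ℕ} (h : IsValid x n) (i : ℕ) :
    degree x i n = attachCount x i n + if 1 ≤ i ∧ i ≤ n then 1 else 0 := by
  have key : (tree x n).neighborSet i =
      ↑(((Finset.Icc 1 n).filter fun k => x k = i) ∪
        (if 1 ≤ i ∧ i ≤ n then {x i} else (∅ : Finset ℕ))) := by
    ext j
    simp only [SimpleGraph.mem_neighborSet, tree, SimpleGraph.fromRel_adj, Finset.coe_union,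
      Set.mem_union, Finset.coe_filter, Finset.mem_Icc, Set.mem_ofPred_eq]
    constructor
    · rintro ⟨hne, ⟨h1, h2, h3⟩ | ⟨h1, h2, h3⟩⟩
      · right; simp [h1, h2, h3]
      · left; exact ⟨⟨h1, h2⟩, h3⟩
    · rintro (⟨⟨h1, h2⟩, h3⟩ | h')
      · have := h j (Finset.mem_Icc.2 ⟨h1, h2⟩)
        exact ⟨by omega, Or.inr ⟨h1, h2, h3⟩⟩
      · split_ifs at h' with hi
        · have hj : j = x i := by simpa using h'
          have := h i (Finset.mem_Icc.2 hi)
          exact ⟨by omega, Or.inl ⟨hi.1, hi.2, hj.symm⟩⟩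
        · simp at h'
  rw [degree, key, Set.ncard_coe_finset, Finset.card_union_of_disjoint]
  · unfold attachCount
    split_ifs <;> simp
  · rw [Finset.disjoint_left]
    intro k hk hk'
    simp only [Finset.mem_filter, Finset.mem_Icc] at hk
    split_ifs at hk' with hi
    · have hk2 : k = x i := by simpa using hk'
      have h1 := h i (Finset.mem_Icc.2 hi)
      have h2 := h k (Finset.mem_Icc.2 hk.1)
      omega
    · simp at hk'

lemma sum_degree {x : ℕ → ℕ} {n : ℕ} (h : IsValid x n) :
    ∑ j ∈ Finset.range (n + 1), degree x j n = 2 * n := by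
  have h1 : ∑ j ∈ Finset.range (n + 1), attachCount x j n = n := by
    have := Finset.card_eq_sum_card_fiberwise (s := Finset.Icc 1 n) (t := Finset.range (n + 1))
      (f := x) (fun k hk => by
        have := h k hk
        simp only [Finset.coe_Icc, Set.mem_Icc] at hk
        simp only [Finset.coe_range, Set.mem_Iio]
        omega)
    simpa [attachCount] using this.symm
  have h2 : ∑ j ∈ Finset.range (n + 1), (if 1 ≤ j ∧ j ≤ n then 1 else 0) = n := by
    rw [← Finset.card_filter]
    have : (Finset.range (n + 1)).filter (fun j => 1 ≤ j ∧ j ≤ n) = Finset.Icc 1 n := by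
      ext j
      simp only [Finset.mem_filter, Finset.mem_range, Finset.mem_Icc]
      omega
    simp [this]
  rw [Finset.sum_congr rfl fun j _ => degree_eq h j, Finset.sum_add_distrib, h1, h2]
  ring

lemma weight_succ (δ d₀ : ℝ) (x : ℕ → ℕ) {i n : ℕ} (h : i ≤ n + 1) :
    weight δ d₀ x i (n + 1) = weight δ d₀ x i n + (degree x i (n + 1) + δ) := by
  unfold weight
  rw [Finset.sum_Icc_succ_top h]
  simp [weightDegree]

/-- The total weight at time `n`, when all attachments are to earlier vertices. -/
noncomputable def totalWeight (δ d₀ : ℝ) (n : ℕ) : ℝ :=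
  (1 + δ / 2) * n ^ 2 + (1 + 3 * δ / 2) * n + (d₀ + δ)

/-- Passing to time `n + 1` adds every degree and one δ per vertex, a deterministic amount by the
handshake lemma. The randomness thus drops out of the normalisation, which makes the conditional
drift of the degree linear. -/
lemma sum_weight (δ d₀ : ℝ) {x : ℕ → ℕ} {n : ℕ} (h : IsValid x n) :
    ∑ j ∈ Finset.range (n + 1), weight δ d₀ x j n = totalWeight δ d₀ n := by
  induction n with
  | zero => simp [weight, weightDegree, totalWeight]
  | succ n ih =>
    have e : ∀ j ∈ Finset.range (n + 1 + 1), weight δ d₀ x j (n + 1) =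
        weight δ d₀ x j n + (degree x j (n + 1) + δ) := fun j hj =>
      weight_succ δ d₀ x (by simp at hj; omega)
    -- The newly arrived vertex has no weight at time `n`: its sum is over an empty interval.
    have h0 : weight δ d₀ x (n + 1) n = 0 := by simp [weight]
    have hs : (∑ j ∈ Finset.range (n + 1 + 1), (degree x j (n + 1) : ℝ)) = 2 * (n + 1) := by
      exact_mod_cast sum_degree h
    rw [Finset.sum_congr rfl e, Finset.sum_add_distrib, Finset.sum_range_succ, h0,
      ih (h.mono (by omega)), Finset.sum_add_distrib, hs]
    simp [totalWeight]
    ring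

/-- The shifted degree `d(v_i, n) + δ` of a vertex `i ≥ 1` that has arrived. -/
noncomputable def shiftedDegree (δ : ℝ) (x : ℕ → ℕ) (i n : ℕ) : ℝ := 1 + attachCount x i n + δ

/-- The sum of the shifted degrees from the arrival of `i` up to time `n`. -/
noncomputable def cumDegree (δ : ℝ) (x : ℕ → ℕ) (i n : ℕ) : ℝ := ∑ m ∈ Finset.Icc i n, shiftedDegree δ x i m

lemma degree_add_eq_shiftedDegree (δ : ℝ) {x : ℕ → ℕ} {i n : ℕ} (h : IsValid x n) (hi : 1 ≤ i)
    (hin : i ≤ n) : degree x i n + δ = shiftedDegree δ x i n := by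
  rw [degree_eq h, if_pos ⟨hi, hin⟩, shiftedDegree]
  push_cast
  ring

lemma weight_eq_cumDegree (δ d₀ : ℝ) {x : ℕ → ℕ} {i n : ℕ} (h : IsValid x n) (hi : 1 ≤ i) :
    weight δ d₀ x i n = cumDegree δ x i n := by
  refine Finset.sum_congr rfl fun m hm => ?_
  rw [Finset.mem_Icc] at hm
  rw [weightDegree, if_neg (by omega),
    degree_add_eq_shiftedDegree δ (h.mono hm.2) hi hm.1]

lemma shiftedDegree_ge (δ : ℝ) (x : ℕ → ℕ) (i n : ℕ) : 1 + δ ≤ shiftedDegree δ x i n := by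
  unfold shiftedDegree
  have : (0 : ℝ) ≤ attachCount x i n := Nat.cast_nonneg _
  linarith

lemma cumDegree_nonneg {δ : ℝ} (hδ : -1 < δ) (x : ℕ → ℕ) (i n : ℕ) : 0 ≤ cumDegree δ x i n :=
  Finset.sum_nonneg fun m _ => by linarith [shiftedDegree_ge δ x i m]

lemma cumDegree_succ (δ : ℝ) (x : ℕ → ℕ) {i n : ℕ} (h : i ≤ n + 1) :
    cumDegree δ x i (n + 1) = cumDegree δ x i n + shiftedDegree δ x i (n + 1) :=
  Finset.sum_Icc_succ_top h _

lemma shiftedDegree_succ (δ : ℝ) (x : ℕ → ℕ) (i n : ℕ) :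
    shiftedDegree δ x i (n + 1) = shiftedDegree δ x i n + if x (n + 1) = i then 1 else 0 := by
  unfold shiftedDegree
  rw [attachCount_succ]
  push_cast
  ring

lemma shiftedDegree_congr (δ : ℝ) {x y : ℕ → ℕ} {n : ℕ} (h : ∀ k ∈ Finset.Icc 1 n, x k = y k)
    (i : ℕ) : shiftedDegree δ x i n = shiftedDegree δ y i n := by
  rw [shiftedDegree, shiftedDegree, attachCount_congr h]

lemma cumDegree_congr (δ : ℝ) {x y : ℕ → ℕ} {n : ℕ} (h : ∀ k ∈ Finset.Icc 1 n, x k = y k)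
    (i : ℕ) : cumDegree δ x i n = cumDegree δ y i n :=
  Finset.sum_congr rfl fun _ hm => shiftedDegree_congr δ
    (fun k hk => h k (Finset.Icc_subset_Icc_right (Finset.mem_Icc.1 hm).2 hk)) i

lemma shiftedDegree_le (δ : ℝ) (x : ℕ → ℕ) (i n : ℕ) : shiftedDegree δ x i n ≤ 1 + n + δ := by
  unfold shiftedDegree
  have : (attachCount x i n : ℝ) ≤ n := by exact_mod_cast attachCount_le x i n
  linarith

lemma cumDegree_le {δ : ℝ} (hδ : -1 < δ) (x : ℕ → ℕ) (i n : ℕ) :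
    cumDegree δ x i n ≤ (n + 1) * (1 + n + δ) := by
  have h1 : cumDegree δ x i n ≤ ∑ m ∈ Finset.Icc i n, (1 + n + δ) := by
    refine Finset.sum_le_sum fun m hm => (shiftedDegree_le δ x i m).trans ?_
    have : (m : ℝ) ≤ n := by exact_mod_cast (Finset.mem_Icc.1 hm).2
    linarith
  rw [Finset.sum_const, nsmul_eq_mul] at h1
  refine h1.trans (mul_le_mul_of_nonneg_right ?_ ?_)
  · have : (Finset.Icc i n).card ≤ n + 1 := by simp
    exact_mod_cast this
  · have : (0 : ℝ) ≤ n := Nat.cast_nonneg _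
    linarith

/-- Expanded in powers of n − 1, the total weight has positive coefficients: 1 + δ/2, 3 + 5δ/2 and
the value (1 + δ) + ((d₀ + δ) + (1 + δ)) at time 1. -/
lemma totalWeight_pos {δ d₀ : ℝ} (hδ : -1 < δ) (hd₀ : 0 ≤ (d₀ + δ) + (1 + δ)) {n : ℕ}
    (hn : 1 ≤ n) : 0 < totalWeight δ d₀ n := by
  have hn' : (1 : ℝ) ≤ n := by exact_mod_cast hn
  unfold totalWeight
  nlinarith [mul_nonneg (by linarith : (0 : ℝ) ≤ 1 + δ) (sub_nonneg.2 hn'),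
    mul_nonneg (mul_nonneg (by linarith : (0 : ℝ) ≤ 1 + δ) (sub_nonneg.2 hn')) (sub_nonneg.2 hn'),
    mul_nonneg (sub_nonneg.2 hn') (sub_nonneg.2 hn')]

/-! ### The exponent and the growth product -/

lemma inv_phi_pos {δ : ℝ} (hδ : -1 < δ) : 0 < 1 / phi δ := by
  have : 0 < 1 + δ / 2 := by linarith
  unfold phi
  positivity

/-- This is the characteristic equation φ² = α(φ + 1), α = 1 + δ/2, written for r = 1/φ. It makes
the leading part of the drift cancel. -/
lemma inv_phi_mul_add_one {δ : ℝ} (hδ : -1 < δ) :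
    (1 + δ / 2) * (1 / phi δ * (1 / phi δ + 1)) = 1 := by
  have hα : 0 < 1 + δ / 2 := by linarith
  unfold phi
  set α := 1 + δ / 2
  have hs : √(1 + 4 * α⁻¹) ^ 2 = 1 + 4 * α⁻¹ := Real.sq_sqrt (by positivity)
  have hs0 := Real.sqrt_nonneg (1 + 4 * α⁻¹)
  set s := √(1 + 4 * α⁻¹)
  have hs1 : α * s ^ 2 = α + 4 := by rw [hs]; field_simp
  have : 1 + s ≠ 0 := by positivity
  field_simp
  nlinarith

/-- The product `∏_{j = 1}^{n} (1 + r / j)`, which grows like `n ^ r`. -/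
noncomputable def growth (r : ℝ) (n : ℕ) : ℝ := ∏ j ∈ Finset.range n, (1 + r / (j + 1))

lemma growth_succ (r : ℝ) (n : ℕ) : growth r (n + 1) = growth r n * (1 + r / (n + 1)) :=
  Finset.prod_range_succ _ _

lemma growth_pos {r : ℝ} (hr : 0 < r) (n : ℕ) : 0 < growth r n :=
  Finset.prod_pos fun j _ => by positivity

lemma growth_strictMono {r : ℝ} (hr : 0 < r) : StrictMono (growth r) :=
  strictMono_nat_of_lt_succ fun n => by
    rw [growth_succ]
    exact lt_mul_of_one_lt_right (growth_pos hr n) (by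
      have : 0 < r / ((n : ℝ) + 1) := by positivity
      linarith)

lemma one_le_growth {r : ℝ} (hr : 0 < r) (n : ℕ) : 1 ≤ growth r n := by
  have := (growth_strictMono hr).monotone (Nat.zero_le n)
  simpa [growth] using this

/-- Euler's sequence for Γ(r) is n^r / (r g(n)), because r(r+1)⋯(r+n) = r · n! · g(n). -/
lemma tendsto_rpow_neg_mul_growth {r : ℝ} (hr : 0 < r) :
    Tendsto (fun n : ℕ => (n : ℝ) ^ (-r) * growth r n) atTop (𝓝 (r * Real.Gamma r)⁻¹) := by
  have h := ((Real.GammaSeq_tendsto_Gamma r).const_mul r).inv₀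
    (mul_ne_zero hr.ne' (Real.Gamma_pos_of_pos hr).ne')
  refine h.congr fun n => ?_
  have e : ∏ j ∈ Finset.range (n + 1), (r + j) = r * (n.factorial * growth r n) := by
    rw [Finset.prod_range_succ', Nat.cast_zero, add_zero, mul_comm]
    congr 1
    rw [growth, ← Finset.prod_range_add_one_eq_factorial, Nat.cast_prod, ← Finset.prod_mul_distrib]
    refine Finset.prod_congr rfl fun j _ => ?_
    push_cast
    field_simp
    ring
  rw [Real.GammaSeq, e, Real.rpow_neg (Nat.cast_nonneg n)]
  have := (growth_pos hr n).ne'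
  have : (n.factorial : ℝ) ≠ 0 := by positivity
  by_cases hn : (n : ℝ) ^ r = 0
  · simp [hn]
  · field_simp

/-! ### Recovering the degree from the combination -/

/-- The Stolz–Cesàro theorem. -/
lemma tendsto_div_of_tendsto_sub_div_sub {A B : ℕ → ℝ} {l : ℝ} (hB : StrictMono B)
    (hB' : Tendsto B atTop atTop)
    (h : Tendsto (fun n => (A (n + 1) - A n) / (B (n + 1) - B n)) atTop (𝓝 l)) :
    Tendsto (fun n => A n / B n) atTop (𝓝 l) := by
  have hb : ∀ n, 0 < B (n + 1) - B n := fun n => sub_pos.2 (hB n.lt_succ_self)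
  have h1 : (fun n => (A (n + 1) - A n) - l * (B (n + 1) - B n)) =o[atTop]
      fun n => B (n + 1) - B n := by
    rw [Asymptotics.isLittleO_iff_tendsto fun n hn => absurd hn (hb n).ne']
    have := h.sub_const l
    rw [sub_self] at this
    refine this.congr fun n => ?_
    have := (hb n).ne'
    field_simp
  have hs : Tendsto (fun n => ∑ k ∈ Finset.range n, (B (k + 1) - B k)) atTop atTop := by
    simp only [Finset.sum_range_sub]
    exact tendsto_atTop_add_const_right _ _ hB'
  have h2 := h1.sum_range (fun n => (hb n).le) hs
  simp only [Finset.sum_sub_distrib, ← Finset.mul_sum] at h2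
  simp only [← Finset.sum_sub_distrib, Finset.sum_range_sub] at h2
  have h3 : (fun n => B n - B 0) =O[atTop] B := by
    refine (Asymptotics.isBigO_refl B atTop).sub ?_
    exact (Asymptotics.isLittleO_const_left.2 (Or.inr (tendsto_norm_atTop_atTop.comp hB'))).isBigO
  have h4 := (h2.trans_isBigO h3).tendsto_div_nhds_zero
  have h5 : Tendsto (fun n => (A 0 - l * B 0) / B n) atTop (𝓝 0) := hB'.const_div_atTop _
  have h6 := (h4.add h5).add_const l
  rw [zero_add, zero_add] at h6
  refine h6.congr' ?_
  filter_upwards [hB'.eventually_gt_atTop 0] with n hn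
  field_simp
  ring

/-- The combination of the shifted degree and of the cumulative degree that is almost a
martingale. -/
noncomputable def combine (r : ℝ) (Y T : ℕ → ℝ) (n : ℕ) : ℝ := (growth r n)⁻¹ * (Y n + r * T n / n)

/-- Writing Y as an increment of T turns the definition of M = `combine r Y T` into a first-order
recursion for T with integrating factor g: g(n+1) T(n+1) − g(n) T(n) = g(n) g(n+1) M(n+1).
Stolz–Cesàro against n g(n)² then gives the limit of T/(n g), and Y/g is M minus r times that
quotient. -/
lemma tendsto_inv_growth_mul {r : ℝ} (hr : 0 < r) {Y T : ℕ → ℝ} {L : ℝ} {n₀ : ℕ}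
    (hT : ∀ n, n₀ ≤ n → T (n + 1) = T n + Y (n + 1))
    (hL : Tendsto (combine r Y T) atTop (𝓝 L)) :
    Tendsto (fun n => (growth r n)⁻¹ * Y n) atTop (𝓝 ((r + 1) / (2 * r + 1) * L)) := by
  have hg := fun n => growth_pos hr n
  have hcast : Tendsto (fun n : ℕ => (n : ℝ)) atTop atTop := tendsto_natCast_atTop_atTop
  have hmono : StrictMono fun n : ℕ => (n : ℝ) * growth r n ^ 2 := by
    refine strictMono_nat_of_lt_succ fun n => ?_
    have h1 : growth r n ^ 2 < growth r (n + 1) ^ 2 :=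
      pow_lt_pow_left₀ (growth_strictMono hr n.lt_succ_self) (hg n).le (by norm_num)
    have h2 : 0 < growth r n ^ 2 := pow_pos (hg n) 2
    have h3 : (0 : ℝ) ≤ n := Nat.cast_nonneg n
    push_cast
    nlinarith
  have htop : Tendsto (fun n : ℕ => (n : ℝ) * growth r n ^ 2) atTop atTop := by
    refine tendsto_atTop_mono (fun n => ?_) hcast
    exact le_mul_of_one_le_right (Nat.cast_nonneg n) (one_le_pow₀ (one_le_growth hr n))
  have hst : Tendsto (fun n : ℕ => growth r n * T n / ((n : ℝ) * growth r n ^ 2)) atTop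
      (𝓝 (L / (2 * r + 1))) := by
    refine tendsto_div_of_tendsto_sub_div_sub hmono htop ?_
    have hden : Tendsto (fun n : ℕ => ((2 * r + 1) * ((n : ℝ) + 1) + r ^ 2) / ((n : ℝ) + 1 + r))
        atTop (𝓝 (2 * r + 1)) := by
      have h0 : Tendsto (fun n : ℕ => (r ^ 2 - (2 * r + 1) * r) / ((n : ℝ) + 1 + r)) atTop
          (𝓝 0) :=
        (tendsto_atTop_add_const_right _ _
          (tendsto_atTop_add_const_right _ _ hcast)).const_div_atTop _
      have := h0.const_add (2 * r + 1)
      rw [add_zero] at this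
      refine this.congr fun n => ?_
      have : (n : ℝ) + 1 + r ≠ 0 := by positivity
      field_simp
      ring
    have h1 := ((tendsto_add_atTop_iff_nat 1).2 hL).div hden (by positivity)
    refine h1.congr' ?_
    filter_upwards [eventually_ge_atTop n₀] with n hn
    simp only [Pi.div_apply, combine]
    rw [hT n hn, growth_succ]
    have hgn := (hg n).ne'
    have hn1 : (n : ℝ) + 1 ≠ 0 := by positivity
    have hn2 : (n : ℝ) + 1 + r ≠ 0 := by positivity
    have hn3 : (2 * r + 1) * ((n : ℝ) + 1) + r ^ 2 ≠ 0 := by positivity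
    have hd : ((n + 1 : ℕ) : ℝ) * (growth r n * (1 + r / (n + 1))) ^ 2 - n * growth r n ^ 2 =
        growth r n ^ 2 * ((2 * r + 1) * ((n : ℝ) + 1) + r ^ 2) / (n + 1) := by
      push_cast
      field_simp
      ring
    rw [hd]
    push_cast
    field_simp
    ring
  have h := hL.sub (hst.const_mul r)
  have e : L - r * (L / (2 * r + 1)) = (r + 1) / (2 * r + 1) * L := by
    field_simp
    ring
  rw [e] at h
  refine h.congr' ?_
  filter_upwards [eventually_gt_atTop 0] with n hn
  have hn' : (n : ℝ) ≠ 0 := by positivity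
  have := (hg n).ne'
  simp only [combine]
  field_simp
  ring

/-! ### Convergence of almost martingales -/

/-- A sequence that is bounded in `L²` and converges almost surely converges in `L¹`. -/
lemma tendsto_eLpNorm_one_of_integral_sq_le {Ω : Type*} [MeasurableSpace Ω] {μ : Measure Ω}
    [IsFiniteMeasure μ] {f : ℕ → Ω → ℝ} {g : Ω → ℝ} {K : ℝ} (hf : ∀ n, MemLp (f n) 2 μ)
    (hK : ∀ n, ∫ ω, f n ω ^ 2 ∂μ ≤ K)
    (hfg : ∀ᵐ ω ∂μ, Tendsto (fun n => f n ω) atTop (𝓝 (g ω))) :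
    MemLp g 1 μ ∧ Tendsto (fun n => eLpNorm (fun ω => f n ω - g ω) 1 μ) atTop (𝓝 0) := by
  have hui : UniformIntegrable f 1 μ := by
    refine uniformIntegrable_of le_rfl ENNReal.one_ne_top (fun n => (hf n).1) fun ε hε => ?_
    -- On the set where |f| ≥ C one has |f| ≤ f²/C, with integral at most K/C ≤ ε. The extra 1 keeps
    -- C positive even for K = 0.
    have hC : 0 < (|K| + 1) / ε := by positivity
    refine ⟨⟨(|K| + 1) / ε, hC.le⟩, fun n => ?_⟩
    set C := (|K| + 1) / ε with hCdef
    have hint : Integrable (fun ω => f n ω ^ 2 / C) μ := (hf n).integrable_sq.div_const _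
    rw [eLpNorm_one_eq_lintegral_enorm]
    calc ∫⁻ ω, ‖({x | (⟨C, hC.le⟩ : NNReal) ≤ ‖f n x‖₊}.indicator (f n)) ω‖ₑ ∂μ
        ≤ ∫⁻ ω, ENNReal.ofReal (f n ω ^ 2 / C) ∂μ := by
          refine lintegral_mono fun ω => ?_
          by_cases h : ω ∈ {x | (⟨C, hC.le⟩ : NNReal) ≤ ‖f n x‖₊}
          · rw [Set.indicator_of_mem h, Real.enorm_eq_ofReal_abs]
            refine ENNReal.ofReal_le_ofReal ?_
            have h' : C ≤ |f n ω| := h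
            rw [le_div_iff₀ hC, ← sq_abs, sq]
            exact mul_le_mul_of_nonneg_left h' (abs_nonneg _)
          · rw [Set.indicator_of_notMem h]
            simp
      _ = ENNReal.ofReal (∫ ω, f n ω ^ 2 / C ∂μ) :=
          (ofReal_integral_eq_lintegral_ofReal hint
            (Eventually.of_forall fun ω => by positivity)).symm
      _ ≤ ENNReal.ofReal ε := by
          refine ENNReal.ofReal_le_ofReal ?_
          rw [integral_div, div_le_iff₀ hC, hCdef, mul_div_cancel₀ _ hε.ne']
          linarith [hK n, le_abs_self K]
  have hg : MemLp g 1 μ := hui.memLp_of_ae_tendsto hfg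
  exact ⟨hg, tendsto_Lp_finite_of_tendsto_ae le_rfl ENNReal.one_ne_top (fun n => (hf n).1) hg
    hui.unifIntegrable hfg⟩

/-- A positive adapted sequence that is a martingale up to summable relative errors, and is bounded
in `L²` up to such errors, converges almost surely to a limit of positive mean. -/
theorem exists_tendsto_of_almost_martingale {Ω : Type*} {m0 : MeasurableSpace Ω} {μ : Measure Ω}
    [IsProbabilityMeasure μ] (ℱ : Filtration ℕ m0) {M : ℕ → Ω → ℝ} {ε v : ℕ → ℝ}
    (hadp : StronglyAdapted ℱ M) (hpos : ∀ n ω, 0 ≤ M n ω) (hM0 : 0 < ∫ ω, M 0 ω ∂μ)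
    (hL2 : ∀ n, MemLp (M n) 2 μ)
    (hε : Summable ε) (hε0 : ∀ n, 0 ≤ ε n) (hε1 : ∀ n, ε n ≤ 1 / 2)
    (hv : Summable v) (hv0 : ∀ n, 0 ≤ v n)
    (hstep : ∀ n s, MeasurableSet[ℱ n] s →
      |∫ ω in s, M (n + 1) ω ∂μ - ∫ ω in s, M n ω ∂μ| ≤ ε n * ∫ ω in s, M n ω ∂μ)
    (hsq : ∀ n, ∫ ω, M (n + 1) ω ^ 2 ∂μ ≤
      (1 + ε n) ^ 2 * ∫ ω, M n ω ^ 2 ∂μ + v n * ∫ ω, M n ω ∂μ) :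
    ∃ L : Ω → ℝ, MemLp L 1 μ ∧ 0 < ∫ ω, L ω ∂μ ∧
      (∀ᵐ ω ∂μ, Tendsto (fun n => M n ω) atTop (𝓝 (L ω))) ∧
      ∃ K, ∀ n, ∫ ω, M n ω ^ 2 ∂μ ≤ K := by
  set σ : ℕ → ℝ := fun n => ∑ k ∈ Finset.range n, ε k with hσ
  set sε := ∑' k, ε k
  have hσ1 : ∀ n, σ (n + 1) = σ n + ε n := fun n => Finset.sum_range_succ _ _
  have hσ0 : ∀ n, 0 ≤ σ n := fun n => Finset.sum_nonneg fun k _ => hε0 k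
  have hσle : ∀ n, σ n ≤ sε := fun n => hε.sum_le_tsum _ fun k _ => hε0 k
  have hint : ∀ n, Integrable (M n) μ := fun n => (hL2 n).integrable (by norm_num)
  have hup : ∀ n s, MeasurableSet[ℱ n] s →
      ∫ ω in s, M (n + 1) ω ∂μ ≤ Real.exp (ε n) * ∫ ω in s, M n ω ∂μ := fun n s hs => by
    have h1 := (abs_le.1 (hstep n s hs)).2
    have h2 : 0 ≤ ∫ ω in s, M n ω ∂μ := integral_nonneg (hpos n)
    nlinarith [Real.add_one_le_exp (ε n)]
  -- Discounting by the accumulated errors makes the process a nonnegative supermartingale, so it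
  -- converges almost surely. The discount factor has a positive limit.
  have hsuper : Supermartingale (fun n ω => Real.exp (-σ n) * M n ω) ℱ μ := by
    refine supermartingale_of_setIntegral_succ_le (fun n => (hadp n).const_mul _)
      (fun n => (hint n).const_mul _) fun n s hs => ?_
    rw [integral_const_mul, integral_const_mul, hσ1, neg_add, Real.exp_add, mul_assoc]
    refine mul_le_mul_of_nonneg_left ?_ (Real.exp_pos _).le
    calc Real.exp (-ε n) * ∫ ω in s, M (n + 1) ω ∂μ
        ≤ Real.exp (-ε n) * (Real.exp (ε n) * ∫ ω in s, M n ω ∂μ) :=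
          mul_le_mul_of_nonneg_left (hup n s hs) (Real.exp_pos _).le
      _ = ∫ ω in s, M n ω ∂μ := by
          rw [← mul_assoc, ← Real.exp_add]; simp
  have hmean : ∀ n, Real.exp (-σ n) * ∫ ω, M n ω ∂μ ≤ ∫ ω, M 0 ω ∂μ := by
    intro n
    have := hsuper.setIntegral_le (Nat.zero_le n) MeasurableSet.univ
    simpa [integral_const_mul, hσ] using this
  have hbdd : ∀ n, eLpNorm ((fun n ω => -(Real.exp (-σ n) * M n ω)) n) 1 μ ≤
      (Real.toNNReal (∫ ω, M 0 ω ∂μ) : ENNReal) := by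
    intro n
    have h0 : ∀ ω, 0 ≤ Real.exp (-σ n) * M n ω :=
      fun ω => mul_nonneg (Real.exp_pos _).le (hpos n ω)
    rw [eLpNorm_one_eq_lintegral_enorm]
    have : ∀ ω, ‖-(Real.exp (-σ n) * M n ω)‖ₑ = ENNReal.ofReal (Real.exp (-σ n) * M n ω) :=
      fun ω => by rw [enorm_neg, Real.enorm_of_nonneg (h0 ω)]
    simp only [this]
    rw [← ofReal_integral_eq_lintegral_ofReal ((hint n).const_mul _) (Eventually.of_forall h0),
      integral_const_mul]
    exact ENNReal.ofReal_le_ofReal (hmean n)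
  set l : Ω → ℝ := fun ω => limUnder atTop fun n => -(Real.exp (-σ n) * M n ω)
  have hlim : ∀ᵐ ω ∂μ, Tendsto (fun n => -(Real.exp (-σ n) * M n ω)) atTop (𝓝 (l ω)) := by
    filter_upwards [hsuper.neg.exists_ae_tendsto_of_bdd hbdd] with ω hω
    exact tendsto_nhds_limUnder hω
  have hconv : ∀ᵐ ω ∂μ, Tendsto (fun n => M n ω) atTop (𝓝 (Real.exp sε * -l ω)) := by
    filter_upwards [hlim] with ω hω
    have h1 : Tendsto (fun n => Real.exp (σ n)) atTop (𝓝 (Real.exp sε)) :=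
      (Real.continuous_exp.tendsto _).comp hε.hasSum.tendsto_sum_nat
    refine (h1.mul hω.neg).congr fun n => ?_
    rw [neg_neg, ← mul_assoc, ← Real.exp_add]
    simp
  have hmeanle : ∀ n, ∫ ω, M n ω ∂μ ≤ Real.exp sε * ∫ ω, M 0 ω ∂μ := by
    intro n
    calc ∫ ω, M n ω ∂μ = Real.exp (σ n) * (Real.exp (-σ n) * ∫ ω, M n ω ∂μ) := by
          rw [← mul_assoc, ← Real.exp_add]; simp
      _ ≤ Real.exp sε * ∫ ω, M 0 ω ∂μ :=
          mul_le_mul (Real.exp_le_exp.2 (hσle n)) (hmean n)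
            (mul_nonneg (Real.exp_pos _).le (integral_nonneg (hpos n))) (Real.exp_pos _).le
  have hmeange : ∀ n, Real.exp (-(2 * σ n)) * ∫ ω, M 0 ω ∂μ ≤ ∫ ω, M n ω ∂μ := by
    intro n
    induction n with
    | zero => simp [hσ]
    | succ n ih =>
      have h1 := (abs_le.1 (hstep n _ MeasurableSet.univ)).1
      simp only [Measure.restrict_univ] at h1
      -- Here ε ≤ 1/2 enters: (1 + 2ε)(1 − ε) ≥ 1 exactly when ε(1 − 2ε) ≥ 0.
      have h2 : Real.exp (-(2 * ε n)) ≤ 1 - ε n := by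
        rw [Real.exp_neg, inv_le_iff_one_le_mul₀ (Real.exp_pos _)]
        have := Real.add_one_le_exp (2 * ε n)
        nlinarith [hε0 n, hε1 n]
      have h3 : 0 ≤ ∫ ω, M n ω ∂μ := integral_nonneg (hpos n)
      have h4 : -(2 * σ (n + 1)) = -(2 * ε n) + -(2 * σ n) := by rw [hσ1]; ring
      rw [h4, Real.exp_add, mul_assoc]
      calc Real.exp (-(2 * ε n)) * (Real.exp (-(2 * σ n)) * ∫ ω, M 0 ω ∂μ)
          ≤ (1 - ε n) * ∫ ω, M n ω ∂μ := mul_le_mul h2 ih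
            (mul_nonneg (Real.exp_pos _).le hM0.le) (by linarith [hε1 n])
        _ ≤ _ := by linarith
  obtain ⟨K, hK⟩ : ∃ K, ∀ n, ∫ ω, M n ω ^ 2 ∂μ ≤ K := by
    set K₁ := Real.exp sε * ∫ ω, M 0 ω ∂μ with hK₁
    have hK₁0 : 0 ≤ K₁ := by positivity
    -- A discrete Grönwall bound, the means being bounded by K₁.
    have key : ∀ n, ∫ ω, M n ω ^ 2 ∂μ ≤ Real.exp (2 * σ n) *
        (∫ ω, M 0 ω ^ 2 ∂μ + K₁ * ∑ k ∈ Finset.range n, v k) := by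
      intro n
      induction n with
      | zero => simp [hσ]
      | succ n ih =>
        have h1 : (1 + ε n) ^ 2 ≤ Real.exp (2 * ε n) := by
          have := Real.add_one_le_exp (ε n)
          rw [two_mul, Real.exp_add, ← sq]
          exact pow_le_pow_left₀ (by linarith [hε0 n]) (by linarith) 2
        have h2 : v n * ∫ ω, M n ω ∂μ ≤ Real.exp (2 * σ (n + 1)) * (K₁ * v n) := by
          have h3 : v n * ∫ ω, M n ω ∂μ ≤ K₁ * v n := by
            rw [mul_comm]
            exact mul_le_mul_of_nonneg_right (hmeanle n) (hv0 n)
          refine h3.trans (le_mul_of_one_le_left (mul_nonneg hK₁0 (hv0 n)) ?_)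
          exact Real.one_le_exp (by linarith [hσ0 (n + 1)])
        have h4 : (1 + ε n) ^ 2 * ∫ ω, M n ω ^ 2 ∂μ ≤ Real.exp (2 * ε n) *
            (Real.exp (2 * σ n) * (∫ ω, M 0 ω ^ 2 ∂μ + K₁ * ∑ k ∈ Finset.range n, v k)) :=
          mul_le_mul h1 ih (integral_nonneg fun ω => sq_nonneg _) (Real.exp_pos _).le
        have h5 : Real.exp (2 * σ (n + 1)) = Real.exp (2 * ε n) * Real.exp (2 * σ n) := by
          rw [← Real.exp_add, hσ1]; ring_nf
        rw [Finset.sum_range_succ]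
        rw [h5] at h2 ⊢
        linarith [hsq n]
    refine ⟨Real.exp (2 * sε) * (∫ ω, M 0 ω ^ 2 ∂μ + K₁ * ∑' k, v k), fun n => (key n).trans ?_⟩
    have h0 : 0 ≤ ∫ ω, M 0 ω ^ 2 ∂μ := integral_nonneg fun ω => sq_nonneg _
    refine mul_le_mul (Real.exp_le_exp.2 (by linarith [hσle n])) ?_ ?_ (Real.exp_pos _).le
    · have := mul_le_mul_of_nonneg_left (hv.sum_le_tsum (Finset.range n) fun k _ => hv0 k) hK₁0
      linarith
    · exact add_nonneg h0 (mul_nonneg hK₁0 (Finset.sum_nonneg fun k _ => hv0 k))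
  obtain ⟨hLmem, hLconv⟩ := tendsto_eLpNorm_one_of_integral_sq_le hL2 hK hconv
  refine ⟨_, hLmem, ?_, hconv, K, hK⟩
  -- L¹ convergence carries the uniform lower bound on the means to the limit; almost sure
  -- convergence alone could lose the mass.
  have hInt : Tendsto (fun n => ∫ ω, M n ω ∂μ) atTop (𝓝 (∫ ω, Real.exp sε * -l ω ∂μ)) :=
    tendsto_integral_of_L1' _ hLmem.1 (Eventually.of_forall hint)
      hLconv
  refine lt_of_lt_of_le (mul_pos (Real.exp_pos (-(2 * sε))) hM0) (ge_of_tendsto' hInt fun n => ?_)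
  refine le_trans (mul_le_mul_of_nonneg_right (Real.exp_le_exp.2 ?_) hM0.le) (hmeange n)
  linarith [hσle n]

/-! ### Conditioning on the history -/

section History

variable {Ω : Type*} {m0 : MeasurableSpace Ω} {μ : Measure Ω} {δ d₀ : ℝ} {a : ℕ → Ω → ℕ}

/-- The first `n` attachments, as a random element of a countable space. -/
def prefixMap (a : ℕ → Ω → ℕ) (n : ℕ) (ω : Ω) : Set.Icc 1 n → ℕ := fun k => a k ω

lemma measurable_prefixMap (ha : ∀ k, 1 ≤ k → Measurable (a k)) (n : ℕ) :
    Measurable (prefixMap a n) :=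
  measurable_pi_lambda _ fun k => ha k k.2.1

lemma history_eq_preimage (a : ℕ → Ω → ℕ) (x : ℕ → ℕ) (n : ℕ) :
    history a x n = prefixMap a n ⁻¹' {(Set.Icc 1 n).domRestrict x} := by
  ext ω
  simp [history, prefixMap, funext_iff, Set.domRestrict]

lemma exists_restrict_eq {n : ℕ} (h : Set.Icc 1 n → ℕ) :
    ∃ x : ℕ → ℕ, (Set.Icc 1 n).domRestrict x = h := by
  classical
  exact ⟨fun k => if hk : k ∈ Set.Icc 1 n then h ⟨k, hk⟩ else 0, by
    ext k
    simp only [Set.domRestrict_apply, dif_pos k.2]⟩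

lemma measurableSet_history (ha : ∀ k, 1 ≤ k → Measurable (a k)) (x : ℕ → ℕ) (n : ℕ) :
    MeasurableSet (history a x n) := by
  rw [history_eq_preimage]
  exact measurable_prefixMap ha n (measurableSet_singleton _)

/-- The history of the tree, observed from time `n₀` on. -/
def historyFiltration (ha : ∀ k, 1 ≤ k → Measurable (a k)) (n₀ : ℕ) : Filtration ℕ m0 where
  seq n := MeasurableSpace.comap (prefixMap a (n₀ + n)) inferInstance
  mono' m n hmn := by
    have hle : Set.Icc 1 (n₀ + m) ⊆ Set.Icc 1 (n₀ + n) := Set.Icc_subset_Icc_right (by omega)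
    have e : prefixMap a (n₀ + m) = (fun h k => h (Set.inclusion hle k)) ∘
        prefixMap a (n₀ + n) := rfl
    change MeasurableSpace.comap _ _ ≤ MeasurableSpace.comap _ _
    rw [e, ← MeasurableSpace.comap_comp]
    exact MeasurableSpace.comap_mono
      (measurable_pi_lambda _ fun k => measurable_pi_apply _).comap_le
  le' n := (measurable_prefixMap ha _).comap_le

lemma stronglyMeasurable_comap_of_dependsOn {z : (ℕ → ℕ) → ℝ} {n : ℕ}
    (hz : DependsOn z (Set.Icc 1 n)) :
    StronglyMeasurable[MeasurableSpace.comap (prefixMap a n) inferInstance]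
      fun ω => z fun k => a k ω := by
  obtain ⟨g, rfl⟩ := dependsOn_iff_exists_comp.1 hz
  have h1 : Measurable[MeasurableSpace.comap (prefixMap a n) inferInstance] (prefixMap a n) :=
    comap_measurable _
  exact (Measurable.comp (g := g) (Measurable.of_discrete) h1).stronglyMeasurable

lemma measurable_of_dependsOn (ha : ∀ k, 1 ≤ k → Measurable (a k)) {z : (ℕ → ℕ) → ℝ} {n : ℕ}
    (hz : DependsOn z (Set.Icc 1 n)) : Measurable fun ω => z fun k => a k ω :=
  (stronglyMeasurable_comap_of_dependsOn hz).measurable.mono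
    (measurable_prefixMap ha n).comap_le le_rfl

/-- The first `n` attachments take countably many values, so the histories form a countable
measurable partition. -/
lemma integral_eq_of_forall_history [IsFiniteMeasure μ] (ha : ∀ k, 1 ≤ k → Measurable (a k))
    {f g : Ω → ℝ} (hf : Integrable f μ) (hg : Integrable g μ) (n : ℕ)
    (h : ∀ x : ℕ → ℕ, ∫ ω in history a x n, f ω ∂μ = ∫ ω in history a x n, g ω ∂μ) :
    ∫ ω, f ω ∂μ = ∫ ω, g ω ∂μ := by
  have hU : ⋃ y, prefixMap a n ⁻¹' {y} = Set.univ := by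
    ext ω; simp
  have hm : ∀ y, MeasurableSet (prefixMap a n ⁻¹' {y}) := fun y =>
    measurable_prefixMap ha n (measurableSet_singleton _)
  have hd : Pairwise (Function.onFun Disjoint fun y => prefixMap a n ⁻¹' {y}) :=
    pairwise_disjoint_fiber _
  rw [← setIntegral_univ, ← setIntegral_univ (f := g), ← hU,
    integral_iUnion hm hd hf.integrableOn, integral_iUnion hm hd hg.integrableOn]
  congr 1
  ext y
  obtain ⟨x, rfl⟩ := exists_restrict_eq y
  rw [← history_eq_preimage]
  exact h x

lemma isValid_of_measure_history_ne_zero {n : ℕ} (h : ∀ᵐ ω ∂μ, IsValid (fun k => a k ω) n)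
    {x : ℕ → ℕ} (hx : μ (history a x n) ≠ 0) : IsValid x n := by
  by_contra hv
  refine hx (measure_mono_null (fun ω hω => ?_) (ae_iff.1 h))
  intro hω'
  refine hv fun k hk => ?_
  rw [← hω k hk]
  exact hω' k hk

/-- The model only prescribes the probabilities of attaching to 0, …, n. They sum to 1 because the
total weight is nonzero, so no mass is left for other targets. The induction is needed since the
total weight is known only on valid histories. -/
lemma ae_isValid [IsProbabilityMeasure μ] (hδ : -1 < δ) (hd₀ : 0 ≤ (d₀ + δ) + (1 + δ))
    (ha : IsSelfReinforcedTree μ δ d₀ a) (n : ℕ) : ∀ᵐ ω ∂μ, IsValid (fun k => a k ω) n := by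
  induction n with
  | zero => exact Eventually.of_forall fun ω k hk => by simp at hk
  | succ n ih =>
    suffices hlast : ∀ᵐ ω ∂μ, a (n + 1) ω < n + 1 by
      filter_upwards [ih, hlast] with ω h1 h2 k hk
      rw [Finset.mem_Icc] at hk
      rcases eq_or_ne k (n + 1) with rfl | hne
      · exact h2
      · exact h1 k (Finset.mem_Icc.2 ⟨hk.1, by omega⟩)
    rcases Nat.eq_zero_or_pos n with rfl | hn
    · filter_upwards [ha.first] with ω hω
      simp [hω]
    · have hm := ha.measurable (n + 1) (by omega)
      have hms : MeasurableSet {ω | a (n + 1) ω < n + 1} := hm (measurableSet_Iio (a := n + 1))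
      have key : ∀ x : ℕ → ℕ, μ (history a x n ∩ {ω | a (n + 1) ω < n + 1}ᶜ) = 0 := by
        intro x
        by_cases hx : μ (history a x n) = 0
        · exact measure_mono_null Set.inter_subset_left hx
        have hmh := measurableSet_history ha.measurable x n
        have hval := isValid_of_measure_history_ne_zero ih hx
        have : IsProbabilityMeasure (cond μ (history a x n)) := cond_isProbabilityMeasure hx
        have hone : (cond μ (history a x n)).real {ω | a (n + 1) ω < n + 1} = 1 := by
          have e : {ω | a (n + 1) ω < n + 1} =
              ⋃ i ∈ Finset.range (n + 1), {ω | a (n + 1) ω = i} := by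
            ext ω; simp
          rw [e, measureReal_biUnion_finset]
          · rw [Finset.sum_congr rfl fun i hi => ha.step n hn x hx i
              (Nat.lt_succ_iff.1 (Finset.mem_range.1 hi)), ← Finset.sum_div]
            refine div_self ?_
            rw [sum_weight δ d₀ hval]
            exact (totalWeight_pos hδ hd₀ hn).ne'
          · intro i _ j _ hij
            refine Set.disjoint_left.2 fun ω h1 h2 => hij ?_
            exact (show a (n + 1) ω = i from h1).symm.trans h2
          · exact fun i _ => hm (measurableSet_singleton i)
        have hzero : cond μ (history a x n) {ω | a (n + 1) ω < n + 1}ᶜ = 0 := by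
          rw [prob_compl_eq_zero_iff hms]
          rw [measureReal_def] at hone
          exact (ENNReal.toReal_eq_one_iff _).1 hone
        rw [← cond_mul_eq_inter hmh, hzero, zero_mul]
      rw [ae_iff]
      have hsub : {ω | ¬a (n + 1) ω < n + 1} ⊆
          ⋃ y, prefixMap a n ⁻¹' {y} ∩ {ω | a (n + 1) ω < n + 1}ᶜ := by
        intro ω hω
        simpa using hω
      refine measure_mono_null hsub (measure_iUnion_null fun y => ?_)
      obtain ⟨x, rfl⟩ := exists_restrict_eq y
      rw [← history_eq_preimage]
      exact key x

/-- The conditional probability of an attachment to `i`, in integrated form. -/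
lemma integral_mul_attach [IsProbabilityMeasure μ] (hδ : -1 < δ)
    (hd₀ : 0 ≤ (d₀ + δ) + (1 + δ)) (ha : IsSelfReinforcedTree μ δ d₀ a) {i n : ℕ} (hi : 1 ≤ i)
    (hin : i ≤ n) {z : (ℕ → ℕ) → ℝ} (hz : DependsOn z (Set.Icc 1 n)) {c : ℝ}
    (hc : ∀ x, |z x| ≤ c) :
    ∫ ω, z (fun k => a k ω) * (if a (n + 1) ω = i then 1 else 0) ∂μ =
      ∫ ω, z (fun k => a k ω) * (cumDegree δ (fun k => a k ω) i n / totalWeight δ d₀ n) ∂μ := by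
  have hn : 1 ≤ n := hi.trans hin
  have hzm := measurable_of_dependsOn ha.measurable hz
  have hTdep : DependsOn (fun x => cumDegree δ x i n) (Set.Icc 1 n) := fun x y h =>
    cumDegree_congr δ (fun k hk => h k (Finset.mem_Icc.1 hk)) i
  have hTm := measurable_of_dependsOn ha.measurable hTdep
  have hset : MeasurableSet {ω | a (n + 1) ω = i} :=
    ha.measurable (n + 1) (by omega) (measurableSet_singleton i)
  have hSpos := totalWeight_pos hδ hd₀ hn
  refine integral_eq_of_forall_history ha.measurable ?_ ?_ n fun x => ?_
  · refine Integrable.of_bound (C := c) (hzm.mul (Measurable.ite hset measurable_const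
      measurable_const)).aestronglyMeasurable (Eventually.of_forall fun ω => ?_)
    rw [Real.norm_eq_abs, abs_mul]
    have := hc fun k => a k ω
    split_ifs
    · simpa using this
    · simpa using (abs_nonneg _).trans this
  · refine Integrable.of_bound (C := c * ((n + 1) * (1 + n + δ) / totalWeight δ d₀ n))
      (hzm.mul (hTm.div_const _)).aestronglyMeasurable (Eventually.of_forall fun ω => ?_)
    rw [Real.norm_eq_abs, abs_mul]
    refine mul_le_mul (hc _) ?_ (abs_nonneg _) ((abs_nonneg _).trans (hc fun _ => 0))
    rw [abs_of_nonneg (div_nonneg (cumDegree_nonneg hδ _ _ _) hSpos.le)]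
    exact div_le_div_of_nonneg_right (cumDegree_le hδ _ _ _) hSpos.le
  -- On a single history both the test function and the weight of `i` are constant, so the identity
  -- reduces to the model's attachment probability.
  · by_cases hx : μ (history a x n) = 0
    · rw [setIntegral_measure_zero _ hx, setIntegral_measure_zero _ hx]
    have hmh := measurableSet_history ha.measurable x n
    have hval := isValid_of_measure_history_ne_zero (ae_isValid hδ hd₀ ha n) hx
    have hagree : ∀ ω ∈ history a x n, ∀ k ∈ Set.Icc 1 n, a k ω = x k := fun ω hω k hk =>
      hω k (Finset.mem_Icc.2 hk)
    have h1 : ∫ ω in history a x n, z (fun k => a k ω) * (if a (n + 1) ω = i then 1 else 0) ∂μ =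
        z x * μ.real (history a x n ∩ {ω | a (n + 1) ω = i}) := by
      rw [setIntegral_congr_fun (g := fun ω => z x * {ω | a (n + 1) ω = i}.indicator 1 ω) hmh,
        integral_const_mul, integral_indicator_one hset, measureReal_restrict_apply hset,
        Set.inter_comm]
      intro ω hω
      simp only [Set.indicator_apply, Set.mem_ofPred_eq, Pi.one_apply]
      rw [hz (hagree ω hω)]
    have h2 : ∫ ω in history a x n, z (fun k => a k ω) *
        (cumDegree δ (fun k => a k ω) i n / totalWeight δ d₀ n) ∂μ =
        z x * (cumDegree δ x i n / totalWeight δ d₀ n) * μ.real (history a x n) := by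
      rw [setIntegral_congr_fun
        (g := fun _ => z x * (cumDegree δ x i n / totalWeight δ d₀ n)) hmh, setIntegral_const,
        smul_eq_mul, mul_comm]
      intro ω hω
      have := hTdep (hagree ω hω)
      simp only at this ⊢
      rw [hz (hagree ω hω), this]
    have h3 := ha.step n hn x hx i hin
    rw [weight_eq_cumDegree δ d₀ hval hi, sum_weight δ d₀ hval, measureReal_def,
      cond_apply hmh, ENNReal.toReal_mul, ENNReal.toReal_inv] at h3
    have hpos : 0 < (μ (history a x n)).toReal := ENNReal.toReal_pos hx (measure_ne_top _ _)
    rw [h1, h2, ← h3, measureReal_def, measureReal_def]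
    field_simp

end History

/-! ### One-step recursion and asymptotic bounds -/

/-- The factor 1 + r/(n+1) removes the Y-term from the drift. What remains is a multiple of T, of
order r(r+1)/n², to be balanced by the mean T/S(n) of `e`. -/
lemma combine_succ {r : ℝ} (hr : 0 < r) {Y T : ℕ → ℝ} {n : ℕ} {e : ℝ} (hn : 1 ≤ n)
    (hY : Y (n + 1) = Y n + e) (hT : T (n + 1) = T n + Y (n + 1)) :
    combine r Y T (n + 1) = combine r Y T n -
      (growth r n)⁻¹ * (r * (r + 1) / (n * (n + 1 + r))) * T n + (growth r n)⁻¹ * e := by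
  have hg := (growth_pos hr n).ne'
  have hn0 : (n : ℝ) ≠ 0 := by positivity
  have hn1 : (n : ℝ) + 1 ≠ 0 := by positivity
  have hn2 : (n : ℝ) + 1 + r ≠ 0 := by positivity
  rw [combine, combine, hT, hY, growth_succ]
  push_cast
  field_simp
  ring

/-- The telescoping differences 1/g(n) − 1/g(n+1) equal r/((n + 1 + r) g(n)), comparable to the
terms in question; n + 1 + r ≤ (2 + r)n for n ≥ 1 gives the constant. -/
lemma summable_inv_growth_div {r : ℝ} (hr : 0 < r) :
    Summable fun n : ℕ => (growth r n)⁻¹ / n := by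
  have hp : ∀ n, 0 < (growth r n)⁻¹ := fun n => inv_pos.2 (growth_pos hr n)
  have htel : Summable fun n : ℕ => (growth r n)⁻¹ - (growth r (n + 1))⁻¹ := by
    refine summable_of_sum_range_le (c := (growth r 0)⁻¹) (fun n => ?_) fun n => ?_
    · exact sub_nonneg.2 (inv_anti₀ (growth_pos hr n)
        ((growth_strictMono hr).monotone n.le_succ))
    · rw [Finset.sum_range_sub']
      linarith [hp n]
  refine Summable.of_nonneg_of_le (fun n => div_nonneg (hp n).le (Nat.cast_nonneg n))
    (fun n => ?_) (htel.mul_left ((2 + r) / r))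
  rcases Nat.eq_zero_or_pos n with rfl | hn
  · simp only [Nat.cast_zero, div_zero]
    refine mul_nonneg (by positivity) ?_
    exact sub_nonneg.2 (inv_anti₀ (growth_pos hr 0) ((growth_strictMono hr).monotone (by simp)))
  · have hn' : (1 : ℝ) ≤ n := by exact_mod_cast hn
    have hg := growth_pos hr n
    have e : (2 + r) / r * ((growth r n)⁻¹ - (growth r (n + 1))⁻¹) =
        (growth r n)⁻¹ * ((2 + r) / (n + 1 + r)) := by
      rw [growth_succ]
      have : (n : ℝ) + 1 + r ≠ 0 := by positivity
      field_simp
      ring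
    rw [e, div_eq_mul_inv]
    refine mul_le_mul_of_nonneg_left ?_ (hp n).le
    rw [inv_eq_one_div, div_le_div_iff₀ (by positivity) (by positivity)]
    nlinarith

lemma exists_totalWeight_bound {δ : ℝ} (hδ : -1 < δ) (d₀ : ℝ) :
    ∃ C : ℝ, ∃ n₁ : ℕ, 0 ≤ C ∧ 1 ≤ n₁ ∧ ∀ n : ℕ, n₁ ≤ n →
      |1 / totalWeight δ d₀ n - 1 / phi δ * (1 / phi δ + 1) / (n * (n + 1 + 1 / phi δ))| ≤
        C / n ^ 3 ∧ 1 / totalWeight δ d₀ n ≤ C / n ^ 2 := by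
  have hr := inv_phi_pos hδ
  have hrα := inv_phi_mul_add_one hδ
  set r := 1 / phi δ
  have hα : 0 < 1 + δ / 2 := by linarith
  set α := 1 + δ / 2 with hαdef
  set b := 1 + 3 * δ / 2 with hb
  set c := d₀ + δ with hc
  set C₁ := 2 * (α * (1 + r) + |b| + |c|) / α ^ 2 with hC₁
  have hC₁0 : 0 ≤ C₁ := by positivity
  -- From this threshold on, the lower-order terms of the total weight are at most half of α n². The
  -- two summands of the constant serve the two bounds.
  refine ⟨C₁ + 2 / α, ⌈2 * (|b| + |c|) / α⌉₊ + 1, by positivity, by omega, fun n hn => ?_⟩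
  have hn1 : (1 : ℝ) ≤ n := by
    have : 1 ≤ n := by omega
    exact_mod_cast this
  have hnb : 2 * (|b| + |c|) ≤ n * α := by
    rw [← div_le_iff₀ hα]
    refine (Nat.le_ceil _).trans ?_
    exact_mod_cast (by omega : ⌈2 * (|b| + |c|) / α⌉₊ ≤ n)
  have hdev : |b * n + c| ≤ (|b| + |c|) * n := by
    refine (abs_add_le _ _).trans ?_
    rw [abs_mul, abs_of_nonneg (by linarith : (0 : ℝ) ≤ n)]
    nlinarith [abs_nonneg c]
  have hS : totalWeight δ d₀ n = α * n ^ 2 + (b * n + c) := by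
    simp only [totalWeight, hαdef, hb, hc]
    ring
  have hSge : α * n ^ 2 / 2 ≤ totalWeight δ d₀ n := by
    rw [hS]
    nlinarith [(abs_le.1 hdev).1]
  have hSpos : 0 < totalWeight δ d₀ n := lt_of_lt_of_le (by positivity) hSge
  constructor
  · have e : r * (r + 1) / (n * (n + 1 + r)) = 1 / (α * (n * (n + 1 + r))) := by
      rw [div_eq_div_iff (by positivity) (by positivity)]
      linear_combination (n * (n + 1 + r)) * hrα
    have hnum : |α * (n * (n + 1 + r)) - totalWeight δ d₀ n| ≤
        (α * (1 + r) + |b| + |c|) * n := by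
      have : α * (n * (n + 1 + r)) - totalWeight δ d₀ n = α * (1 + r) * n - (b * n + c) := by
        rw [hS]; ring
      rw [this]
      refine (abs_sub _ _).trans ?_
      rw [abs_of_nonneg (by positivity : 0 ≤ α * (1 + r) * n)]
      linarith
    rw [e, div_sub_div _ _ hSpos.ne' (by positivity), one_mul, mul_one, abs_div,
      abs_of_pos (by positivity : 0 < totalWeight δ d₀ n * (α * (n * (n + 1 + r))))]
    have hden : α * n ^ 2 / 2 * (α * n ^ 2) ≤
        totalWeight δ d₀ n * (α * (n * (n + 1 + r))) := by
      refine mul_le_mul hSge ?_ (by positivity) hSpos.le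
      refine mul_le_mul_of_nonneg_left ?_ hα.le
      nlinarith
    calc _ ≤ (α * (1 + r) + |b| + |c|) * n / (α * n ^ 2 / 2 * (α * n ^ 2)) :=
          div_le_div₀ (by positivity) hnum (by positivity) hden
      _ = C₁ / n ^ 3 := by
          rw [hC₁]
          field_simp
      _ ≤ _ := by
          refine div_le_div_of_nonneg_right ?_ (by positivity)
          have : 0 ≤ 2 / α := by positivity
          linarith
  · calc 1 / totalWeight δ d₀ n ≤ 1 / (α * n ^ 2 / 2) :=
          one_div_le_one_div_of_le (by positivity) hSge
      _ = 2 / α / n ^ 2 := by field_simp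
      _ ≤ _ := div_le_div_of_nonneg_right (by linarith) (by positivity)

/-! ### Bounded functions of the history -/

/-- A bounded function of the attachments at times `1, …, n`. -/
def IsObservable (n : ℕ) (z : (ℕ → ℕ) → ℝ) : Prop :=
  DependsOn z (Set.Icc 1 n) ∧ ∃ c, ∀ x, |z x| ≤ c

namespace IsObservable

variable {n : ℕ} {z w : (ℕ → ℕ) → ℝ}

lemma const (c : ℝ) : IsObservable n fun _ => c := ⟨fun _ _ _ => rfl, |c|, fun _ => le_rfl⟩

lemma add (hz : IsObservable n z) (hw : IsObservable n w) :
    IsObservable n fun x => z x + w x := by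
  obtain ⟨hz, c, hc⟩ := hz
  obtain ⟨hw, d, hd⟩ := hw
  exact ⟨fun x y h => by simp only [hz h, hw h], c + d,
    fun x => (abs_add_le _ _).trans (add_le_add (hc x) (hd x))⟩

lemma mul (hz : IsObservable n z) (hw : IsObservable n w) :
    IsObservable n fun x => z x * w x := by
  obtain ⟨hz, c, hc⟩ := hz
  obtain ⟨hw, d, hd⟩ := hw
  refine ⟨fun x y h => by simp only [hz h, hw h], c * d, fun x => ?_⟩
  rw [abs_mul]
  exact mul_le_mul (hc x) (hd x) (abs_nonneg _) ((abs_nonneg _).trans (hc x))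

lemma const_mul (c : ℝ) (hz : IsObservable n z) : IsObservable n fun x => c * z x :=
  (const c).mul hz

lemma sub (hz : IsObservable n z) (hw : IsObservable n w) :
    IsObservable n fun x => z x - w x := by
  simpa [sub_eq_add_neg] using hz.add (hw.const_mul (-1))

lemma pow_two (hz : IsObservable n z) : IsObservable n fun x => z x ^ 2 := by
  simpa [sq] using hz.mul hz

variable {Ω : Type*} {m0 : MeasurableSpace Ω} {μ : Measure Ω} {a : ℕ → Ω → ℕ}

lemma memLp [IsFiniteMeasure μ] (hz : IsObservable n z) (ha : ∀ k, 1 ≤ k → Measurable (a k))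
    (q : ENNReal) : MemLp (fun ω => z fun k => a k ω) q μ := by
  obtain ⟨hz, c, hc⟩ := hz
  exact MemLp.of_bound (measurable_of_dependsOn ha hz).aestronglyMeasurable c
    (Eventually.of_forall fun ω => hc _)

lemma integrable [IsFiniteMeasure μ] (hz : IsObservable n z)
    (ha : ∀ k, 1 ≤ k → Measurable (a k)) : Integrable (fun ω => z fun k => a k ω) μ :=
  memLp_one_iff_integrable.1 (hz.memLp ha 1)

end IsObservable

lemma isObservable_shiftedDegree {δ : ℝ} (hδ : -1 < δ) (i n : ℕ) :
    IsObservable n fun x => shiftedDegree δ x i n := by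
  refine ⟨fun x y h => shiftedDegree_congr δ (fun k hk => h k (Finset.mem_Icc.1 hk)) i,
    1 + n + δ, fun x => ?_⟩
  rw [abs_of_nonneg (by linarith [shiftedDegree_ge δ x i n])]
  exact shiftedDegree_le δ x i n

lemma isObservable_cumDegree {δ : ℝ} (hδ : -1 < δ) (i n : ℕ) :
    IsObservable n fun x => cumDegree δ x i n := by
  refine ⟨fun x y h => cumDegree_congr δ (fun k hk => h k (Finset.mem_Icc.1 hk)) i,
    (n + 1) * (1 + n + δ), fun x => ?_⟩
  rw [abs_of_nonneg (cumDegree_nonneg hδ x i n)]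
  exact cumDegree_le hδ x i n

/-! ### The almost martingale of a vertex -/

/-- The rescaled combination of the degree of `i` and of its weight that is almost a martingale. -/
noncomputable def almostMartingale (δ : ℝ) (i n : ℕ) (x : ℕ → ℕ) : ℝ :=
  combine (1 / phi δ) (shiftedDegree δ x i) (cumDegree δ x i) n

lemma isObservable_almostMartingale {δ : ℝ} (hδ : -1 < δ) (i n : ℕ) :
    IsObservable n (almostMartingale δ i n) := by
  have h := ((isObservable_shiftedDegree hδ i n).add
    ((isObservable_cumDegree hδ i n).const_mul (1 / phi δ / n))).const_mul
    (growth (1 / phi δ) n)⁻¹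
  have e : almostMartingale δ i n = fun x => (growth (1 / phi δ) n)⁻¹ *
      (shiftedDegree δ x i n + 1 / phi δ / n * cumDegree δ x i n) := by
    ext x
    rw [almostMartingale, combine]
    ring
  rwa [e]

lemma inv_growth_mul_shiftedDegree_le {δ : ℝ} (hδ : -1 < δ) (i n : ℕ) (x : ℕ → ℕ) :
    (growth (1 / phi δ) n)⁻¹ * shiftedDegree δ x i n ≤ almostMartingale δ i n x := by
  have hr := inv_phi_pos hδ
  have hg := growth_pos hr n
  refine mul_le_mul_of_nonneg_left ?_ (by positivity)
  have := cumDegree_nonneg hδ x i n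
  have : 0 ≤ 1 / phi δ * cumDegree δ x i n / n := by positivity
  linarith

lemma inv_growth_mul_cumDegree_le {δ : ℝ} (hδ : -1 < δ) {i n : ℕ} (hn : 1 ≤ n) (x : ℕ → ℕ) :
    (growth (1 / phi δ) n)⁻¹ * cumDegree δ x i n ≤
      n / (1 / phi δ) * almostMartingale δ i n x := by
  have hr := inv_phi_pos hδ
  have hg := growth_pos hr n
  have hY : 0 < shiftedDegree δ x i n := by linarith [shiftedDegree_ge δ x i n]
  have hn' : (0 : ℝ) < n := by exact_mod_cast hn
  rw [almostMartingale, combine]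
  have e : n / (1 / phi δ) * ((growth (1 / phi δ) n)⁻¹ *
      (shiftedDegree δ x i n + 1 / phi δ * cumDegree δ x i n / n)) =
      n / (1 / phi δ) * ((growth (1 / phi δ) n)⁻¹ * shiftedDegree δ x i n) +
      (growth (1 / phi δ) n)⁻¹ * cumDegree δ x i n := by
    generalize 1 / phi δ = r at *
    field_simp
  rw [e]
  have : 0 ≤ n / (1 / phi δ) * ((growth (1 / phi δ) n)⁻¹ * shiftedDegree δ x i n) := by
    positivity
  linarith

lemma almostMartingale_pos {δ : ℝ} (hδ : -1 < δ) (i n : ℕ) (x : ℕ → ℕ) :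
    0 < almostMartingale δ i n x := by
  refine lt_of_lt_of_le ?_ (inv_growth_mul_shiftedDegree_le hδ i n x)
  have hg := growth_pos (inv_phi_pos hδ) n
  have hY : 0 < shiftedDegree δ x i n := by linarith [shiftedDegree_ge δ x i n]
  positivity

/-- The part of `almostMartingale δ i (n + 1)` that is determined at time `n`. -/
noncomputable def predictedPart (δ : ℝ) (i n : ℕ) (x : ℕ → ℕ) : ℝ :=
  almostMartingale δ i n x - (growth (1 / phi δ) n)⁻¹ *
    (1 / phi δ * (1 / phi δ + 1) / (n * (n + 1 + 1 / phi δ))) * cumDegree δ x i n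

lemma isObservable_predictedPart {δ : ℝ} (hδ : -1 < δ) (i n : ℕ) :
    IsObservable n (predictedPart δ i n) :=
  (isObservable_almostMartingale hδ i n).sub ((isObservable_cumDegree hδ i n).const_mul _)

lemma almostMartingale_succ {δ : ℝ} (hδ : -1 < δ) {i n : ℕ} (hi : 1 ≤ i) (hin : i ≤ n)
    (x : ℕ → ℕ) : almostMartingale δ i (n + 1) x =
      predictedPart δ i n x + (growth (1 / phi δ) n)⁻¹ * if x (n + 1) = i then 1 else 0 :=
  combine_succ (inv_phi_pos hδ) (hi.trans hin) (shiftedDegree_succ δ x i n)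
    (cumDegree_succ δ x (by omega))

/-- The conditional expectation of `almostMartingale δ i (n + 1)` given the history up to `n`. -/
noncomputable def condMean (δ d₀ : ℝ) (i n : ℕ) (x : ℕ → ℕ) : ℝ :=
  predictedPart δ i n x +
    (growth (1 / phi δ) n)⁻¹ * (cumDegree δ x i n / totalWeight δ d₀ n)

lemma isObservable_cumDegree_div {δ : ℝ} (hδ : -1 < δ) (d₀ : ℝ) (i n : ℕ) :
    IsObservable n fun x => cumDegree δ x i n / totalWeight δ d₀ n := by
  simpa [div_eq_mul_inv] using (isObservable_cumDegree hδ i n).mul (.const (totalWeight δ d₀ n)⁻¹)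

lemma isObservable_condMean {δ : ℝ} (hδ : -1 < δ) (d₀ : ℝ) (i n : ℕ) :
    IsObservable n (condMean δ d₀ i n) :=
  (isObservable_predictedPart hδ i n).add ((isObservable_cumDegree_div hδ d₀ i n).const_mul _)

/-- The drift is T/g times an O(n⁻³) discrepancy, and T/g is at most n/r times the process itself: a
relative error O(n⁻²). -/
lemma abs_condMean_sub_le {δ d₀ C : ℝ} (hδ : -1 < δ) {i n : ℕ} (hn : 1 ≤ n)
    (hC : |1 / totalWeight δ d₀ n -
      1 / phi δ * (1 / phi δ + 1) / (n * (n + 1 + 1 / phi δ))| ≤ C / n ^ 3) (x : ℕ → ℕ) :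
    |condMean δ d₀ i n x - almostMartingale δ i n x| ≤
      C / (1 / phi δ) / n ^ 2 * almostMartingale δ i n x := by
  have hr := inv_phi_pos hδ
  have hg := growth_pos hr n
  have hn' : (0 : ℝ) < n := by exact_mod_cast hn
  have hT := cumDegree_nonneg hδ x i n
  have e : condMean δ d₀ i n x - almostMartingale δ i n x =
      (growth (1 / phi δ) n)⁻¹ * cumDegree δ x i n * (1 / totalWeight δ d₀ n -
        1 / phi δ * (1 / phi δ + 1) / (n * (n + 1 + 1 / phi δ))) := by
    rw [condMean, predictedPart]
    ring
  have h0 : 0 ≤ C / (n : ℝ) ^ 3 := (abs_nonneg _).trans hC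
  rw [e, abs_mul, abs_of_nonneg (by positivity)]
  calc _ ≤ n / (1 / phi δ) * almostMartingale δ i n x * (C / n ^ 3) :=
        mul_le_mul (inv_growth_mul_cumDegree_le hδ hn x) hC (abs_nonneg _)
          (mul_nonneg (by positivity) (almostMartingale_pos hδ i n x).le)
    _ = _ := by
        generalize 1 / phi δ = r at *
        field_simp

/-! ### Conditional moment estimates -/

section TreeProcess

variable {Ω : Type*} {m0 : MeasurableSpace Ω} {μ : Measure Ω} [IsProbabilityMeasure μ]
  {δ d₀ : ℝ} {a : ℕ → Ω → ℕ} {i n : ℕ}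

lemma integrable_attach (ha : ∀ k, 1 ≤ k → Measurable (a k)) {z : (ℕ → ℕ) → ℝ}
    (hz : IsObservable n z) (i : ℕ) :
    Integrable (fun ω => z (fun k => a k ω) * if a (n + 1) ω = i then 1 else 0) μ := by
  refine (hz.integrable ha).mul_bdd (c := 1) ?_ (Eventually.of_forall fun ω => ?_)
  · exact (Measurable.ite (ha (n + 1) (by omega) (measurableSet_singleton i)) measurable_const
      measurable_const).aestronglyMeasurable
  · split_ifs <;> simp

lemma integral_mul_almostMartingale_succ (hδ : -1 < δ) (hd₀ : 0 ≤ (d₀ + δ) + (1 + δ))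
    (ha : IsSelfReinforcedTree μ δ d₀ a) (hi : 1 ≤ i) (hin : i ≤ n) {z : (ℕ → ℕ) → ℝ}
    (hz : IsObservable n z) :
    ∫ ω, z (fun k => a k ω) * almostMartingale δ i (n + 1) (fun k => a k ω) ∂μ =
      ∫ ω, z (fun k => a k ω) * condMean δ d₀ i n (fun k => a k ω) ∂μ := by
  have hpz := hz.const_mul (growth (1 / phi δ) n)⁻¹
  obtain ⟨hpzd, c, hc⟩ := id hpz
  have key := integral_mul_attach hδ hd₀ ha hi hin hpzd hc
  have hA := (hz.mul (isObservable_predictedPart hδ i n)).integrable (μ := μ) ha.measurable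
  have h1 := integral_add hA (integrable_attach ha.measurable hpz i)
  have h2 := integral_add hA
    ((hpz.mul (isObservable_cumDegree_div hδ d₀ i n)).integrable ha.measurable)
  rw [key, ← h2] at h1
  convert h1 using 3 with ω ω
  · rw [almostMartingale_succ hδ hi hin]
    ring
  · rw [condMean]
    ring

/-- The attachment indicator equals its square, so the new square is affine in it and its
conditional mean q can be substituted. The Bernoulli variance q(1 − q) is bounded by q. -/
lemma integral_almostMartingale_succ_sq (hδ : -1 < δ) (hd₀ : 0 ≤ (d₀ + δ) + (1 + δ))
    (ha : IsSelfReinforcedTree μ δ d₀ a) (hi : 1 ≤ i) (hin : i ≤ n) :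
    ∫ ω, almostMartingale δ i (n + 1) (fun k => a k ω) ^ 2 ∂μ ≤
      ∫ ω, (condMean δ d₀ i n (fun k => a k ω) ^ 2 + (growth (1 / phi δ) n)⁻¹ ^ 2 *
        (cumDegree δ (fun k => a k ω) i n / totalWeight δ d₀ n)) ∂μ := by
  set p := (growth (1 / phi δ) n)⁻¹ with hp
  have hA := isObservable_predictedPart hδ i n
  have hz := (hA.const_mul (2 * p)).add (.const (p ^ 2))
  obtain ⟨hzd, c, hc⟩ := id hz
  have key := integral_mul_attach hδ hd₀ ha hi hin hzd hc
  have hA2 := hA.pow_two.integrable (μ := μ) ha.measurable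
  have hR := hz.mul (isObservable_cumDegree_div hδ d₀ i n)
  have h1 := integral_add hA2 (integrable_attach ha.measurable hz i)
  rw [key, ← integral_add hA2 (hR.integrable ha.measurable)] at h1
  have h2 : ∫ ω, almostMartingale δ i (n + 1) (fun k => a k ω) ^ 2 ∂μ =
      ∫ ω, (predictedPart δ i n (fun k => a k ω) ^ 2 +
        (2 * p * predictedPart δ i n (fun k => a k ω) + p ^ 2) *
          (cumDegree δ (fun k => a k ω) i n / totalWeight δ d₀ n)) ∂μ := by
    rw [← h1]
    congr 1
    ext ω
    rw [almostMartingale_succ hδ hi hin, ← hp]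
    split_ifs <;> ring
  rw [h2]
  refine integral_mono (hA2.add (hR.integrable ha.measurable))
    (((isObservable_condMean hδ d₀ i n).pow_two.add
      ((isObservable_cumDegree_div hδ d₀ i n).const_mul _)).integrable ha.measurable) fun ω => ?_
  simp only [condMean, ← hp]
  nlinarith [sq_nonneg (p * (cumDegree δ (fun k => a k ω) i n / totalWeight δ d₀ n))]

lemma abs_setIntegral_almostMartingale_sub_le {C : ℝ} (hδ : -1 < δ)
    (hd₀ : 0 ≤ (d₀ + δ) + (1 + δ)) (ha : IsSelfReinforcedTree μ δ d₀ a) (hi : 1 ≤ i)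
    (hin : i ≤ n)
    (hC : |1 / totalWeight δ d₀ n -
      1 / phi δ * (1 / phi δ + 1) / (n * (n + 1 + 1 / phi δ))| ≤ C / n ^ 3) {s : Set Ω}
    (hs : MeasurableSet[MeasurableSpace.comap (prefixMap a n) inferInstance] s) :
    |∫ ω in s, almostMartingale δ i (n + 1) (fun k => a k ω) ∂μ -
      ∫ ω in s, almostMartingale δ i n (fun k => a k ω) ∂μ| ≤
      C / (1 / phi δ) / n ^ 2 * ∫ ω in s, almostMartingale δ i n (fun k => a k ω) ∂μ := by
  obtain ⟨B, hB, rfl⟩ := hs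
  have hs := measurable_prefixMap ha.measurable n hB
  -- The indicator of an event of the past is a legitimate test function, which turns the weighted
  -- identity into one on the event.
  have hz : IsObservable n fun x => ((Set.Icc 1 n).domRestrict ⁻¹' B).indicator 1 x := by
    classical
    refine ⟨fun x y h => ?_, 1, fun x => ?_⟩
    · have : (Set.Icc 1 n).domRestrict x = (Set.Icc 1 n).domRestrict y :=
        funext fun k => h k k.2
      simp only [Set.indicator_apply, Set.mem_preimage, this, Pi.one_apply]
    · simp only [Set.indicator_apply]
      split_ifs <;> simp
  have hset : ∀ f : Ω → ℝ, ∫ ω in prefixMap a n ⁻¹' B, f ω ∂μ =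
      ∫ ω, ((Set.Icc 1 n).domRestrict ⁻¹' B).indicator 1 (fun k => a k ω) * f ω ∂μ := by
    classical
    intro f
    rw [← integral_indicator hs]
    congr 1
    ext ω
    have : ω ∈ prefixMap a n ⁻¹' B ↔ (fun k => a k ω) ∈ (Set.Icc 1 n).domRestrict ⁻¹' B :=
      Iff.rfl
    simp only [Set.indicator_apply, this]
    split_ifs <;> simp
  have hM := (isObservable_almostMartingale hδ i n).integrable (μ := μ) ha.measurable
  have hN := (isObservable_condMean hδ d₀ i n).integrable (μ := μ) ha.measurable
  rw [hset, integral_mul_almostMartingale_succ hδ hd₀ ha hi hin hz, ← hset,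
    ← integral_sub hN.integrableOn hM.integrableOn, ← integral_const_mul]
  refine (abs_integral_le_integral_abs).trans (integral_mono
    (hN.integrableOn.sub hM.integrableOn).abs (hM.integrableOn.const_mul _) fun ω => ?_)
  exact abs_condMean_sub_le hδ (hi.trans hin) hC _

lemma integral_almostMartingale_succ_sq_le {C : ℝ} (hδ : -1 < δ)
    (hd₀ : 0 ≤ (d₀ + δ) + (1 + δ)) (ha : IsSelfReinforcedTree μ δ d₀ a) (hi : 1 ≤ i)
    (hin : i ≤ n)
    (hC : |1 / totalWeight δ d₀ n -
      1 / phi δ * (1 / phi δ + 1) / (n * (n + 1 + 1 / phi δ))| ≤ C / n ^ 3)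
    (hC' : 1 / totalWeight δ d₀ n ≤ C / n ^ 2) :
    ∫ ω, almostMartingale δ i (n + 1) (fun k => a k ω) ^ 2 ∂μ ≤
      (1 + C / (1 / phi δ) / n ^ 2) ^ 2 *
        ∫ ω, almostMartingale δ i n (fun k => a k ω) ^ 2 ∂μ +
      C / (1 / phi δ) * ((growth (1 / phi δ) n)⁻¹ / n) *
        ∫ ω, almostMartingale δ i n (fun k => a k ω) ∂μ := by
  have hM := isObservable_almostMartingale hδ i n
  have hn := hi.trans hin
  have hn' : (0 : ℝ) < n := by exact_mod_cast hn
  have hr := inv_phi_pos hδ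
  have hg := growth_pos hr n
  have hS := totalWeight_pos hδ hd₀ hn
  refine (integral_almostMartingale_succ_sq hδ hd₀ ha hi hin).trans ?_
  rw [← integral_const_mul, ← integral_const_mul,
    ← integral_add ((hM.pow_two.const_mul _).integrable ha.measurable)
      ((hM.const_mul _).integrable ha.measurable)]
  refine integral_mono (((isObservable_condMean hδ d₀ i n).pow_two.add
      ((isObservable_cumDegree_div hδ d₀ i n).const_mul _)).integrable ha.measurable)
    (((hM.pow_two.const_mul _).add (hM.const_mul _)).integrable ha.measurable) fun ω => ?_
  set x : ℕ → ℕ := fun k => a k ω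
  have hMpos := almostMartingale_pos hδ i n x
  have hT := cumDegree_nonneg hδ x i n
  refine add_le_add ?_ ?_
  · rw [← mul_pow]
    have h := abs_condMean_sub_le (i := i) hδ hn hC x
    have h0 := abs_nonneg (condMean δ d₀ i n x - almostMartingale δ i n x)
    refine sq_le_sq' ?_ ?_
    · linarith [(abs_le.1 h).1]
    · linarith [(abs_le.1 h).2]
  · have h1 := inv_growth_mul_cumDegree_le (i := i) hδ hn x
    calc (growth (1 / phi δ) n)⁻¹ ^ 2 * (cumDegree δ x i n / totalWeight δ d₀ n)
        = (growth (1 / phi δ) n)⁻¹ * (((growth (1 / phi δ) n)⁻¹ * cumDegree δ x i n) *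
            (1 / totalWeight δ d₀ n)) := by ring
      _ ≤ (growth (1 / phi δ) n)⁻¹ * ((n / (1 / phi δ) * almostMartingale δ i n x) *
            (C / n ^ 2)) := by
          refine mul_le_mul_of_nonneg_left ?_ (by positivity)
          exact mul_le_mul h1 hC' (by positivity) (by positivity)
      _ = _ := by
          generalize 1 / phi δ = r at *
          field_simp

theorem exists_tendsto_almostMartingale (hδ : -1 < δ) (hd₀ : 0 ≤ (d₀ + δ) + (1 + δ))
    (ha : IsSelfReinforcedTree μ δ d₀ a) (hi : 1 ≤ i) :
    ∃ L : Ω → ℝ, MemLp L 1 μ ∧ 0 < ∫ ω, L ω ∂μ ∧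
      (∀ᵐ ω ∂μ, Tendsto (fun n => almostMartingale δ i n fun k => a k ω) atTop (𝓝 (L ω))) ∧
      ∃ K, ∃ n₀ : ℕ, ∀ n, ∫ ω, almostMartingale δ i (n + n₀) (fun k => a k ω) ^ 2 ∂μ ≤ K := by
  obtain ⟨C, n₁, hC0, hn₁, hC⟩ := exists_totalWeight_bound hδ d₀
  have hr := inv_phi_pos hδ
  set D := C / (1 / phi δ) with hD
  have hD0 : 0 ≤ D := by positivity
  -- Starting this late ensures that `i` has arrived, that the weight bounds hold, and that D/n² ≤
  -- 1/2.
  set n₀ := n₁ + i + ⌈2 * D⌉₊ with hn₀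
  have hobs := fun n => isObservable_almostMartingale hδ i n
  have hge : ∀ n, 1 ≤ ((n₀ + n : ℕ) : ℝ) ∧ 2 * D ≤ ((n₀ + n : ℕ) : ℝ) := fun n =>
    ⟨by exact_mod_cast (by omega : 1 ≤ n₀ + n),
      (Nat.le_ceil _).trans (by exact_mod_cast (by omega : ⌈2 * D⌉₊ ≤ n₀ + n))⟩
  have hM0 : 0 < ∫ ω, almostMartingale δ i (n₀ + 0) (fun k => a k ω) ∂μ := by
    rw [integral_pos_iff_support_of_nonneg
      (fun ω => (almostMartingale_pos hδ i _ _).le) ((hobs _).integrable ha.measurable)]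
    have : (Function.support fun ω => almostMartingale δ i (n₀ + 0) fun k => a k ω) =
        Set.univ := by
      ext ω
      simp [(almostMartingale_pos hδ i n₀ fun k => a k ω).ne']
    rw [this]
    simp
  have hε : Summable fun n : ℕ => D / ((n₀ + n : ℕ) : ℝ) ^ 2 := by
    have h := (summable_nat_add_iff n₀).2 (Real.summable_nat_pow_inv.2 (by norm_num : 1 < 2))
    simpa only [div_eq_mul_inv, add_comm] using h.mul_left D
  have hε1 : ∀ n : ℕ, D / ((n₀ + n : ℕ) : ℝ) ^ 2 ≤ 1 / 2 := fun n => by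
    obtain ⟨h1, h2⟩ := hge n
    rw [div_le_iff₀ (by positivity)]
    nlinarith
  have hv : Summable fun n : ℕ =>
      D * ((growth (1 / phi δ) (n₀ + n))⁻¹ / ((n₀ + n : ℕ) : ℝ)) := by
    have h := ((summable_nat_add_iff n₀).2 (summable_inv_growth_div hr)).mul_left D
    simpa only [add_comm] using h
  obtain ⟨L, hL1, hL2, hL3, K, hK⟩ := exists_tendsto_of_almost_martingale (μ := μ)
    (historyFiltration ha.measurable n₀)
    (M := fun n ω => almostMartingale δ i (n₀ + n) fun k => a k ω)
    (fun n => stronglyMeasurable_comap_of_dependsOn (hobs (n₀ + n)).1)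
    (fun n ω => (almostMartingale_pos hδ i _ _).le)
    hM0 (fun n => (hobs _).memLp ha.measurable 2) hε (fun n => by positivity) hε1 hv
    (fun n => by
      have := growth_pos hr (n₀ + n)
      positivity)
    (fun n s hs => abs_setIntegral_almostMartingale_sub_le hδ hd₀ ha hi
      (show i ≤ n₀ + n by omega) (hC (n₀ + n) (by omega)).1 hs)
    (fun n => integral_almostMartingale_succ_sq_le hδ hd₀ ha hi
      (show i ≤ n₀ + n by omega) (hC (n₀ + n) (by omega)).1 (hC (n₀ + n) (by omega)).2)
  refine ⟨L, hL1, hL2, ?_, K, n₀, fun n => ?_⟩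
  · filter_upwards [hL3] with ω hω
    rw [← tendsto_add_atTop_iff_nat n₀]
    simpa only [add_comm] using hω
  · rw [add_comm]
    exact hK n

end TreeProcess

/-! ### Return to the rescaled degree -/

section TreeProcess

variable {Ω : Type*} {m0 : MeasurableSpace Ω} {μ : Measure Ω} [IsProbabilityMeasure μ]
  {δ d₀ : ℝ} {a : ℕ → Ω → ℕ} {i : ℕ}

lemma tendsto_scaled_shiftedDegree_sub (hδ : -1 < δ) {x : ℕ → ℕ} {L : ℝ}
    (hL : Tendsto (fun n => almostMartingale δ i n x) atTop (𝓝 L)) :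
    Tendsto (fun n : ℕ => (n : ℝ) ^ (-(1 / phi δ)) * (shiftedDegree δ x i n - δ)) atTop
      (𝓝 ((1 / phi δ * Real.Gamma (1 / phi δ))⁻¹ *
        ((1 / phi δ + 1) / (2 * (1 / phi δ) + 1)) * L)) := by
  have hr := inv_phi_pos hδ
  have h1 := tendsto_inv_growth_mul hr (n₀ := i)
    (fun n hn => cumDegree_succ δ x (by omega : i ≤ n + 1)) hL
  have h2 := (tendsto_rpow_neg_atTop hr).comp tendsto_natCast_atTop_atTop
  have h3 := ((tendsto_rpow_neg_mul_growth hr).mul h1).sub (h2.mul_const δ)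
  rw [zero_mul, sub_zero, ← mul_assoc] at h3
  refine h3.congr fun n => ?_
  have := (growth_pos hr n).ne'
  simp only [Function.comp_apply]
  field_simp

/-- Since −δ < 1 and Y ≥ 1 + δ, the degree Y − δ is at most a constant times Y even for negative δ.
This transfers the L² bound to the rescaled degree. -/
lemma exists_scaled_shiftedDegree_sub_le (hδ : -1 < δ) (i : ℕ) :
    ∃ G : ℝ, ∀ (n : ℕ) (x : ℕ → ℕ),
      |(n : ℝ) ^ (-(1 / phi δ)) * (shiftedDegree δ x i n - δ)| ≤
        G * almostMartingale δ i n x := by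
  have hr := inv_phi_pos hδ
  obtain ⟨G, hG⟩ := (tendsto_rpow_neg_mul_growth hr).bddAbove_range
  have hδ' : 0 < 1 + δ := by linarith
  refine ⟨G * (1 + 1 / (1 + δ)), fun n x => ?_⟩
  have hg := growth_pos hr n
  have hY := shiftedDegree_ge δ x i n
  have hY0 : 0 < shiftedDegree δ x i n := by linarith
  have hD : shiftedDegree δ x i n - δ ≤ (1 + 1 / (1 + δ)) * shiftedDegree δ x i n := by
    have : 1 ≤ 1 / (1 + δ) * shiftedDegree δ x i n := by
      rw [one_div, ← div_eq_inv_mul]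
      exact (one_le_div hδ').2 hY
    linarith
  have hGn : (n : ℝ) ^ (-(1 / phi δ)) * growth (1 / phi δ) n ≤ G := hG ⟨n, rfl⟩
  have hn0 : (0 : ℝ) ≤ (n : ℝ) ^ (-(1 / phi δ)) := Real.rpow_nonneg (Nat.cast_nonneg n) _
  have hM := inv_growth_mul_shiftedDegree_le hδ i n x
  rw [abs_of_nonneg (mul_nonneg hn0 (by linarith))]
  calc (n : ℝ) ^ (-(1 / phi δ)) * (shiftedDegree δ x i n - δ)
      ≤ (n : ℝ) ^ (-(1 / phi δ)) * ((1 + 1 / (1 + δ)) * shiftedDegree δ x i n) :=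
        mul_le_mul_of_nonneg_left hD hn0
    _ = ((n : ℝ) ^ (-(1 / phi δ)) * growth (1 / phi δ) n) * ((1 + 1 / (1 + δ)) *
          ((growth (1 / phi δ) n)⁻¹ * shiftedDegree δ x i n)) := by
        generalize (n : ℝ) ^ (-(1 / phi δ)) = t
        have := hg.ne'
        field_simp
    _ ≤ G * ((1 + 1 / (1 + δ)) * almostMartingale δ i n x) := by
        refine mul_le_mul hGn (mul_le_mul_of_nonneg_left hM (by positivity)) (by positivity) ?_
        exact (mul_nonneg hn0 hg.le).trans hGn
    _ = _ := by ring

lemma ae_scaledDegree_eq (hδ : -1 < δ) (hd₀ : 0 ≤ (d₀ + δ) + (1 + δ))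
    (ha : IsSelfReinforcedTree μ δ d₀ a) (hi : 1 ≤ i) :
    ∀ᵐ ω ∂μ, ∀ n, i ≤ n → scaledDegree δ a i n ω =
      (n : ℝ) ^ (-(1 / phi δ)) * (shiftedDegree δ (fun k => a k ω) i n - δ) := by
  filter_upwards [ae_all_iff.2 fun n => ae_isValid hδ hd₀ ha n] with ω hω n hn
  rw [scaledDegree, ← degree_add_eq_shiftedDegree δ (hω n) hi hn, add_sub_cancel_right]

end TreeProcess

end SelfReinforced

open SelfReinforced

theorem theorem2p5 {Ω : Type*} [MeasurableSpace Ω] (μ : Measure Ω) [IsProbabilityMeasure μ]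
    (δ d₀ : ℝ) (hδ : -1 < δ) (hd₀ : 0 ≤ (d₀ + δ) + (1 + δ))
    (a : ℕ → Ω → ℕ) (ha : SelfReinforced.IsSelfReinforcedTree μ δ d₀ a)
    (i : ℕ) (hi : 1 ≤ i) :
    ∃ ζ : Ω → ℝ, MemLp ζ 1 μ ∧ 0 < ∫ ω, ζ ω ∂μ ∧
      (∀ᵐ ω ∂μ, Tendsto (fun n : ℕ => SelfReinforced.scaledDegree δ a i n ω) atTop (𝓝 (ζ ω))) ∧
      Tendsto (fun n : ℕ => eLpNorm (fun ω => SelfReinforced.scaledDegree δ a i n ω - ζ ω) 1 μ)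
        atTop (𝓝 0) := by
  have hr := inv_phi_pos hδ
  obtain ⟨L, -, hLpos, hL, K, n₀, hK⟩ := exists_tendsto_almostMartingale hδ hd₀ ha hi
  obtain ⟨G, hG⟩ := exists_scaled_shiftedDegree_sub_le hδ i
  have heq := ae_scaledDegree_eq hδ hd₀ ha hi
  set κ := (1 / phi δ * Real.Gamma (1 / phi δ))⁻¹ *
    ((1 / phi δ + 1) / (2 * (1 / phi δ) + 1)) with hκ
  have hκ0 : 0 < κ := by
    have := Real.Gamma_pos_of_pos hr
    positivity
  have hlim : ∀ᵐ ω ∂μ, Tendsto (fun n : ℕ => (n : ℝ) ^ (-(1 / phi δ)) *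
      (shiftedDegree δ (fun k => a k ω) i n - δ)) atTop (𝓝 (κ * L ω)) := by
    filter_upwards [hL] with ω hω using tendsto_scaled_shiftedDegree_sub hδ hω
  have hobs : ∀ n : ℕ, IsObservable n fun x =>
      (n : ℝ) ^ (-(1 / phi δ)) * (shiftedDegree δ x i n - δ) := fun n =>
    ((isObservable_shiftedDegree hδ i n).sub (.const δ)).const_mul _
  -- The sequence is shifted by `n₀` because the second-moment bound is available only from that
  -- time on.
  obtain ⟨hζ, hconv⟩ := tendsto_eLpNorm_one_of_integral_sq_le (μ := μ) (K := G ^ 2 * K)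
    (f := fun n ω => ((n + n₀ : ℕ) : ℝ) ^ (-(1 / phi δ)) *
      (shiftedDegree δ (fun k => a k ω) i (n + n₀) - δ)) (g := fun ω => κ * L ω)
    (fun n => (hobs (n + n₀)).memLp ha.measurable 2)
    (fun n => by
      refine le_trans ?_ (mul_le_mul_of_nonneg_left (hK n) (sq_nonneg G))
      rw [← integral_const_mul]
      refine integral_mono ((hobs _).pow_two.integrable ha.measurable)
        (((isObservable_almostMartingale hδ i _).pow_two.const_mul _).integrable ha.measurable)
        fun ω => ?_
      simp only
      rw [← mul_pow]
      exact sq_le_sq.2 ((hG _ _).trans (le_abs_self _)))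
    (by filter_upwards [hlim] with ω hω using (tendsto_add_atTop_iff_nat n₀).2 hω)
  refine ⟨fun ω => κ * L ω, hζ, ?_, ?_, ?_⟩
  · rw [integral_const_mul]
    exact mul_pos hκ0 hLpos
  · filter_upwards [hlim, heq] with ω hω hω'
    refine hω.congr' ?_
    filter_upwards [eventually_ge_atTop i] with n hn
    exact (hω' n hn).symm
  · refine (tendsto_add_atTop_iff_nat n₀).1 (hconv.congr' ?_)
    filter_upwards [eventually_ge_atTop i] with n hn
    refine eLpNorm_congr_ae ?_
    filter_upwards [heq] with ω hω
    rw [hω (n + n₀) (by omega)]
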